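/- Let $\{\omega_m\}_{m\ge 1}$ be a sequence of positive real numbers. Let $X$ be the Jacobi operator on $\ell_2(\mathbb{N})$ (with orthonormal basis $\delta_0,\delta_1,\dots$) whose domain is the space of finitely supported sequences and whose matrix is tridiagonal with zero diagonal and off-diagonal entries $\sqrt{\omega_1},\sqrt{\omega_2},\dots$, so that $X\delta_0=\sqrt{\omega_1}\,\delta_1$ and $X\delta_k=\sqrt{\omega_k}\,\delta_{k-1}+\sqrt{\omega_{k+1}}\,\delta_{k+1}$ for $k\ge 1$. Let $X^*$ be its adjoint, and let $X_m$ be the truncation of this matrix to the indices $0,\dots,m$. Put $Y^{(m)}=(i-X_m)^{-1}$, regarded as a bounded operator on $\ell_2(\mathbb{N})$ that vanishes on the orthogonal complement of $\mathrm{span}(\delta_0,\dots,\delta_m)$, and $G_m(i)=\langle Y^{(m)}\delta_0,\delta_0\rangle$. Put $G_{\mathrm{even}}=\lim_m G_{2m}(i)$ and $G_{\mathrm{odd}}=\lim_m G_{2m+1}(i)$; these limits exist. Let $B_{-1}=B_0=1$ and $B_m=B_{m-1}+\omega_mB_{m-2}$ for $m\ge1$. The sequence $\{\omega_m\}$ has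 property (SC) if one of the following conditions (which are equivalent) holds: (1) $G_{\mathrm{even}}\ne G_{\mathrm{odd}}$; (2) $\lim_{m\to\infty}\prod_{n=1}^m\left(1-\frac{B_{n-1}}{B_n}\right)>0$; (3) $\lim_{m\to\infty}\sum_{n=1}^m\frac{B_{n-1}}{B_n}<\infty$. **Proposition.** Suppose that $\{\omega_m\}$ has property (SC). Then the sequences $\{Y^{(2m)}\}_m$ and $\{Y^{(2m+1)}\}_m$ converge in the strong operator topology to bounded operators $Y^{\mathrm{even}}$ and $Y^{\mathrm{odd}}$, whose images are contained in $\mathrm{Dom}(X^*)$. Define $X_{\mathrm{even}}=X^*|_{\mathrm{Image}\,Y^{\mathrm{even}}}$ and $X_{\mathrm{odd}}=X^*|_{\mathrm{Image}\,Y^{\mathrm{odd}}}$. Then: - $X_{\mathrm{even}}$ and $X_{\mathrm{odd}}$ are extensions of $X$; - $X_{\mathrm{even}}$ and $X_{\mathrm{odd}}$ are self-adjoint; - $X$, $X_{\mathrm{even}}$ and $X_{\mathrm{odd}}$ have finite moments of all orders with respect to the state $\langle\,\cdot\,\delta_0,\delta_0\rangle$ (that is, $\delta_0$ lies in the domain of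 every power), these moments $M_n=\langle X^n\delta_0,\delta_0\rangle=\langle X_{\mathrm{even}}^n\delta_0,\delta_0\rangle=\langle X_{\mathrm{odd}}^n\delta_0,\delta_0\rangle$ coincide and are real, and their Jacobi sequence is $\{\omega_m\}$: $M_0=1$, and there are monic polynomials $P_n$ of degree $n$, orthogonal with positive square norms for the functional $x^n\mapsto M_n$, with $xP_0=P_1$ and $xP_n=P_{n+1}+\omega_nP_{n-1}$ for $n\ge1$; - the operators $i-X_{\mathrm{even}}$ and $i-X_{\mathrm{odd}}$ have bounded inverses, and the Stieltjes transforms at $i$ are $\langle(i-X_{\mathrm{even}})^{-1}\delta_0,\delta_0\rangle=G_{\mathrm{even}}$ and $\langle(i-X_{\mathrm{odd}})^{-1}\delta_0,\delta_0\rangle=G_{\mathrm{odd}}$, and these two numbers are different. -/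

import Mathlib

open Filter Topology

noncomputable section

namespace JacobiMoment

/-- The Hilbert space `ℓ₂(ℕ)` of square summable complex sequences. -/
abbrev EllTwo : Type := lp (fun _ : ℕ => ℂ) 2

/-- The unit vector `δ_k`. -/
def delta (k : ℕ) : EllTwo := lp.single 2 k (1 : ℂ)

/-! A Jacobi sequence `ω_1, ω_2, …` is a function `ω : ℕ → ℝ` whose value at `0` is never used. -/

/-- The tridiagonal matrix with zero diagonal and off-diagonal entries `√ω_1, √ω_2, …`
applied to a column of numbers. -/
def jacobiAction (ω : ℕ → ℝ) (v : ℕ → ℂ) : ℕ → ℂ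
  | 0 => (Real.sqrt (ω 1) : ℂ) * v 1
  | n + 1 => (Real.sqrt (ω (n + 1)) : ℂ) * v n + (Real.sqrt (ω (n + 2)) : ℂ) * v (n + 2)

theorem jacobiAction_add (ω : ℕ → ℝ) (v w : ℕ → ℂ) :
    jacobiAction ω (v + w) = jacobiAction ω v + jacobiAction ω w := by
  funext n
  cases n <;> simp [jacobiAction] <;> ring

theorem jacobiAction_smul (ω : ℕ → ℝ) (c : ℂ) (v : ℕ → ℂ) :
    jacobiAction ω (c • v) = c • jacobiAction ω v := by
  funext n
  cases n <;> simp [jacobiAction] <;> ring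

theorem jacobiAction_support_finite (ω : ℕ → ℝ) (v : ℕ → ℂ) (hv : (Function.support v).Finite) :
    (Function.support (jacobiAction ω v)).Finite := by
  obtain ⟨N, hN⟩ := hv.bddAbove
  have hz : ∀ k, N < k → v k = 0 := by
    intro k hk
    by_contra h
    exact absurd (hN h) (by omega)
  refine (Set.finite_Iic (N + 1)).subset ?_
  intro n hn
  by_contra h
  simp only [Set.mem_Iic, not_le] at h
  apply hn
  cases n with
  | zero => omega
  | succ k => simp [jacobiAction, hz k (by omega), hz (k + 2) (by omega)]

theorem memlp_of_support_finite (v : ℕ → ℂ) (hv : (Function.support v).Finite) :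
    Memℓp (E := fun _ : ℕ => ℂ) v 2 :=
  (memℓp_zero (E := fun _ : ℕ => ℂ) hv).of_exponent_ge zero_le

/-- The algebraic direct sum `⊕_ℕ ℂ ⊂ ℓ₂(ℕ)` of finitely supported sequences. -/
def finSupp : Submodule ℂ EllTwo where
  carrier := {ξ | (Function.support (ξ : ℕ → ℂ)).Finite}
  add_mem' {a b} ha hb := by
    refine (Set.Finite.union ha hb).subset ?_
    exact Function.support_add (a : ℕ → ℂ) (b : ℕ → ℂ)
  zero_mem' := by
    change (Function.support (fun _ : ℕ => (0 : ℂ))).Finite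
    simp
  smul_mem' c x hx := by
    refine Set.Finite.subset hx ?_
    exact Function.support_const_smul_subset c (x : ℕ → ℂ)

/-- The Jacobi operator `X` with domain the finitely supported sequences. -/
def jacobiOp (ω : ℕ → ℝ) : EllTwo →ₗ.[ℂ] EllTwo where
  domain := finSupp
  toFun :=
    { toFun := fun ξ => ⟨jacobiAction ω ((ξ : EllTwo) : ℕ → ℂ),
        memlp_of_support_finite _ (jacobiAction_support_finite ω _ ξ.2)⟩
      map_add' := fun _ _ => Subtype.ext (jacobiAction_add ω _ _)
      map_smul' := fun c _ => Subtype.ext (jacobiAction_smul ω c _) }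

/-- The truncated `(m + 1) × (m + 1)` Jacobi matrix `X_m`. -/
def truncMatrix (ω : ℕ → ℝ) (m : ℕ) : Matrix (Fin (m + 1)) (Fin (m + 1)) ℂ :=
  Matrix.of fun l k =>
    if (l : ℕ) + 1 = k then (Real.sqrt (ω k) : ℂ)
    else if (k : ℕ) + 1 = l then (Real.sqrt (ω l) : ℂ)
    else 0

/-- The matrix `(i - X_m)⁻¹`. -/
def truncResolventMatrix (ω : ℕ → ℝ) (m : ℕ) : Matrix (Fin (m + 1)) (Fin (m + 1)) ℂ :=
  (Complex.I • (1 : Matrix (Fin (m + 1)) (Fin (m + 1)) ℂ) - truncMatrix ω m)⁻¹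

/-- `(i - X_m)⁻¹` as an operator on `ℓ₂(ℕ)`: it acts on `ℓ₂({0, …, m})` and vanishes on the
orthogonal complement. -/
def truncResolvent (ω : ℕ → ℝ) (m : ℕ) : EllTwo →L[ℂ] EllTwo :=
  ∑ l : Fin (m + 1), ∑ k : Fin (m + 1),
    truncResolventMatrix ω m l k • (innerSL ℂ (delta k)).smulRight (delta l)

/-- The Stieltjes transform `G_m(i)` of `X_m` at `i`, the upper-left entry of `(i - X_m)⁻¹`. -/
def truncStieltjes (ω : ℕ → ℝ) (m : ℕ) : ℂ := truncResolventMatrix ω m 0 0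

/-- `G_even = lim G_{2m}(i)`. -/
def GEven (ω : ℕ → ℝ) : ℂ := limUnder atTop fun m : ℕ => truncStieltjes ω (2 * m)

/-- `G_odd = lim G_{2m+1}(i)`. -/
def GOdd (ω : ℕ → ℝ) : ℂ := limUnder atTop fun m : ℕ => truncStieltjes ω (2 * m + 1)

/-- The sequence `B_0 = 1`, `B_1 = 1 + ω_1`, `B_m = B_{m-1} + ω_m B_{m-2}`. -/
def seqB (ω : ℕ → ℝ) : ℕ → ℝ
  | 0 => 1
  | 1 => 1 + ω 1
  | n + 2 => seqB ω (n + 1) + ω (n + 2) * seqB ω n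

/-- Property (SC): at least one of three conditions (equivalent for positive `ω`) holds, namely
`G_even ≠ G_odd`, `lim ∏_{n=1}^m (1 - B_{n-1}/B_n) > 0`, `lim ∑_{n=1}^m B_{n-1}/B_n < ∞`. -/
def PropertySC (ω : ℕ → ℝ) : Prop :=
  GEven ω ≠ GOdd ω ∨
  (∃ L : ℝ, 0 < L ∧
    Tendsto (fun m : ℕ => ∏ n ∈ Finset.range m, (1 - seqB ω n / seqB ω (n + 1))) atTop (𝓝 L)) ∨
  (∃ S : ℝ,
    Tendsto (fun m : ℕ => ∑ n ∈ Finset.range m, seqB ω n / seqB ω (n + 1)) atTop (𝓝 S))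

/-- `Y` is the limit of `A` in the strong operator topology. -/
def IsStrongLimit (A : ℕ → EllTwo →L[ℂ] EllTwo) (Y : EllTwo →L[ℂ] EllTwo) : Prop :=
  ∀ ξ, Tendsto (fun m => A m ξ) atTop (𝓝 (Y ξ))

/-- The restriction of `X*` to the image of `Y`. -/
def adjointOnImage (ω : ℕ → ℝ) (Y : EllTwo →L[ℂ] EllTwo) : EllTwo →ₗ.[ℂ] EllTwo :=
  (jacobiOp ω).adjoint.domRestrict (LinearMap.range (Y : EllTwo →ₗ[ℂ] EllTwo))

/-- The bounded operator `R` is the two-sided inverse `(z - T)⁻¹` of `z - T : Dom T → ℓ₂(ℕ)`. -/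
def IsResolvent (T : EllTwo →ₗ.[ℂ] EllTwo) (z : ℂ) (R : EllTwo →L[ℂ] EllTwo) : Prop :=
  (∀ ξ : EllTwo, ∃ h : R ξ ∈ T.domain, z • R ξ - T ⟨R ξ, h⟩ = ξ) ∧
  (∀ ξ : T.domain, R (z • (ξ : EllTwo) - T ξ) = ξ)

/-- `z - T` has a bounded inverse, and the Stieltjes transform `⟨(z - T)⁻¹ δ_0, δ_0⟩` is `g`
(Mathlib's inner product is linear in its second entry). -/
def HasStieltjesTransform (T : EllTwo →ₗ.[ℂ] EllTwo) (z g : ℂ) : Prop :=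
  ∃ R : EllTwo →L[ℂ] EllTwo, IsResolvent T z R ∧ inner ℂ (delta 0) (R (delta 0)) = g

theorem HasStieltjesTransform.unique {T : EllTwo →ₗ.[ℂ] EllTwo} {z g g' : ℂ}
    (h : HasStieltjesTransform T z g) (h' : HasStieltjesTransform T z g') : g = g' := by
  obtain ⟨R, hR, rfl⟩ := h
  obtain ⟨R', hR', rfl⟩ := h'
  obtain ⟨hm, he⟩ := hR.1 (delta 0)
  have h2 := hR'.2 ⟨R (delta 0), hm⟩
  rw [he] at h2
  rw [h2]

/-- All powers `T^n δ_0` exist, and the moments `⟨T^n δ_0, δ_0⟩` with respect to the state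
`⟨· δ_0, δ_0⟩` are the real numbers `M n`; here `v n = T^n δ_0`. -/
def HasMoments (T : EllTwo →ₗ.[ℂ] EllTwo) (M : ℕ → ℝ) : Prop :=
  ∃ v : ℕ → EllTwo, v 0 = delta 0 ∧
    (∀ n, ∃ h : v n ∈ T.domain, T ⟨v n, h⟩ = v (n + 1)) ∧
    ∀ n, inner ℂ (delta 0) (v n) = (M n : ℂ)

/-- The linear functional on polynomials with `X ^ n ↦ M n`. -/
def momentFunctional (M : ℕ → ℝ) (p : Polynomial ℝ) : ℝ := p.sum fun n a => a * M n

/-- `ω` is the Jacobi sequence of the (symmetric) moment sequence `M`: the monic orthogonal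
polynomials `P_n` of `M` satisfy `x P_n = P_{n+1} + ω_n P_{n-1}`, with `P_{-1} = 0`. -/
def IsJacobiSequence (M ω : ℕ → ℝ) : Prop :=
  M 0 = 1 ∧ ∃ P : ℕ → Polynomial ℝ,
    (∀ n, (P n).Monic ∧ (P n).natDegree = n) ∧
    (∀ m n, m ≠ n → momentFunctional M (P m * P n) = 0) ∧
    (∀ n, 0 < momentFunctional M (P n * P n)) ∧
    Polynomial.X * P 0 = P 1 ∧
    ∀ n, Polynomial.X * P (n + 1) = P (n + 2) + Polynomial.C (ω (n + 1)) * P n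

end JacobiMoment

end

open JacobiMoment

/-!
The resolvents `Y_m = (i - X_m)⁻¹` of the truncations have norm at most `1`, satisfy the resolvent
identity, and on a finitely supported vector `(i - X) x` eventually return `x`. Since `δ_0` is
cyclic for `X`, a subsequence of `Y_m` converges strongly as soon as `Y_m δ_0` converges along it.
The limit `Y` satisfies the resolvent identity as well and inverts `i - X`; hence its range is the
domain of a self-adjoint extension of `X` whose resolvent at `i` is `Y`.

Let `p_l` be the modulus at `i` of the orthonormal polynomial of degree `l`, and
`S_n = ∑ k ≤ n, p_k ^ 2`. The `l`-th coordinate of `Y_m δ_0` is `(-i) ^ (l + 1) p_l` times the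
alternating sum `1 / S_l - 1 / S_{l+1} + ⋯ ± 1 / S_m`. The partial sums of `∑ (-1) ^ j / S_j` that
end with an even or an odd `j` converge separately, and the two limits differ by `s = lim 1 / S_n`.
Each form of (SC) says that `s > 0`, that is, `p` is square summable. Then the coordinatewise
convergence of `Y_m δ_0` along even and along odd `m` is dominated by `p`, and the two limits have
different zeroth coordinates.
-/

namespace JacobiMoment

theorem tendsto_two_mul_atTop : Tendsto (fun m : ℕ => 2 * m) atTop atTop :=
  tendsto_id.const_mul_atTop' two_pos

theorem tendsto_two_mul_add_one_atTop : Tendsto (fun m : ℕ => 2 * m + 1) atTop atTop :=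
  tendsto_atTop_mono (fun _ => Nat.le_succ _) tendsto_two_mul_atTop

section AlternatingSums

variable {a : ℕ → ℝ}

theorem exists_tendsto_alternating_sum {s : ℝ} (ha : Antitone a) (hs : Tendsto a atTop (𝓝 s)) :
    ∃ t, Tendsto (fun m => ∑ j ∈ Finset.range (2 * m + 1), (-1) ^ j * a j) atTop (𝓝 (t + s)) ∧
      Tendsto (fun m => ∑ j ∈ Finset.range (2 * m + 1 + 1), (-1) ^ j * a j) atTop (𝓝 t) := by
  have hanti : Antitone fun j => a j - s := fun j k h => sub_le_sub_right (ha h) s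
  obtain ⟨t, ht⟩ := hanti.tendsto_alternating_series_of_tendsto_zero (by simpa using hs.sub_const s)
  have split (n : ℕ) : ∑ j ∈ Finset.range n, (-1) ^ j * a j =
      ∑ j ∈ Finset.range n, (-1) ^ j * (a j - s) + if Even n then 0 else s := by
    rw [← sub_eq_iff_eq_add', ← Finset.sum_sub_distrib]
    calc ∑ j ∈ Finset.range n, ((-1) ^ j * a j - (-1) ^ j * (a j - s))
        = (∑ j ∈ Finset.range n, (-1) ^ j) * s := by
          rw [Finset.sum_mul]; exact Finset.sum_congr rfl fun j _ => by ring
      _ = if Even n then 0 else s := by rw [neg_one_geom_sum]; split_ifs <;> simp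
  refine ⟨t, ?_, ?_⟩
  · refine ((ht.comp tendsto_two_mul_add_one_atTop).add_const s).congr fun m => ?_
    simp [split]
  · refine (ht.comp <| (tendsto_add_atTop_nat 1).comp tendsto_two_mul_add_one_atTop).congr
      fun m => ?_
    simp [split, Nat.even_add_one]

/-- The sum `a_l - a_{l+1} + a_{l+2} - ⋯ ± a_m`, equal to `0` if `m < l`. The entries of the first
column of a truncated resolvent are, up to simple factors, of this form. -/
noncomputable def alternatingTail (a : ℕ → ℝ) (m l : ℕ) : ℝ :=
  (-1) ^ l * ∑ j ∈ Finset.Ico l (m + 1), (-1) ^ j * a j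

theorem alternatingTail_zero_right (m : ℕ) :
    alternatingTail a m 0 = ∑ j ∈ Finset.range (m + 1), (-1) ^ j * a j := by
  rw [alternatingTail, pow_zero, one_mul, Nat.Ico_zero_eq_range]

theorem alternatingTail_of_lt {m l : ℕ} (h : m < l) : alternatingTail a m l = 0 := by
  rw [alternatingTail, Finset.Ico_eq_empty (by omega), Finset.sum_empty, mul_zero]

theorem alternatingTail_add_succ {m l : ℕ} (h : l ≤ m) :
    alternatingTail a m l + alternatingTail a m (l + 1) = a l := by
  have hsq : (-1 : ℝ) ^ l * (-1) ^ l = 1 := by rw [← mul_pow]; norm_num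
  rw [alternatingTail, alternatingTail, Finset.sum_eq_sum_Ico_succ_bot (by omega), pow_succ]
  linear_combination a l * hsq

theorem alternatingTail_mem_Icc (ha : Antitone a) (ha₀ : ∀ j, 0 ≤ a j) (m l : ℕ) :
    alternatingTail a m l ∈ Set.Icc 0 (a l) := by
  rcases lt_or_ge m l with hl | hl
  · simp [alternatingTail_of_lt hl, ha₀ l]
  · induction hl using Nat.decreasingInduction with
    | self => simp [eq_sub_of_add_eq (alternatingTail_add_succ le_rfl),
        alternatingTail_of_lt (lt_add_one m), ha₀ m]
    | of_succ l hl ih =>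
      have hle := ha l.le_succ
      have hadd := alternatingTail_add_succ (a := a) (Nat.le_of_succ_le hl)
      exact ⟨by linarith [ih.2], by linarith [ih.1]⟩

theorem exists_tendsto_alternatingTail {σ : ℕ → ℕ} {t : ℝ} (hσ : Tendsto σ atTop atTop)
    (ht : Tendsto (fun n => ∑ j ∈ Finset.range (σ n + 1), (-1) ^ j * a j) atTop (𝓝 t)) (l : ℕ) :
    ∃ u, Tendsto (fun n => alternatingTail a (σ n) l) atTop (𝓝 u) := by
  refine ⟨_, ((ht.sub_const (∑ j ∈ Finset.range l, (-1) ^ j * a j)).const_mul ((-1) ^ l)).congr' ?_⟩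
  filter_upwards [hσ.eventually_ge_atTop l] with n hn
  rw [alternatingTail, Finset.sum_Ico_eq_sub _ (by omega)]

end AlternatingSums

section Sequences

variable {ω : ℕ → ℝ}

/-- The sequence `B_{n-1}`, with index shifted so that it starts at `B_{-1}`. It is the modulus at
`i` of the `n`-th monic orthogonal polynomial. -/
def absMonicPoly (ω : ℕ → ℝ) : ℕ → ℝ
  | 0 => 1
  | n + 1 => seqB ω n

/-- The modulus at `i` of the `n`-th orthonormal polynomial. -/
noncomputable def absPoly (ω : ℕ → ℝ) (n : ℕ) : ℝ :=
  absMonicPoly ω n / ∏ k ∈ Finset.range n, √(ω (k + 1))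

/-- The reciprocal of the Christoffel function at `i`, the sum of the squared moduli at `i` of the
orthonormal polynomials up to degree `n`. -/
noncomputable def christoffelSum (ω : ℕ → ℝ) (n : ℕ) : ℝ :=
  ∑ k ∈ Finset.range (n + 1), absPoly ω k ^ 2

theorem absMonicPoly_add_two (ω : ℕ → ℝ) : ∀ n, absMonicPoly ω (n + 2) =
    absMonicPoly ω (n + 1) + ω (n + 1) * absMonicPoly ω n
  | 0 => by simp [absMonicPoly, seqB]
  | _ + 1 => rfl

theorem absMonicPoly_pos (hω : ∀ n, 1 ≤ n → 0 < ω n) : ∀ n, 0 < absMonicPoly ω n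
  | 0 => one_pos
  | 1 => one_pos
  | n + 2 => by
    have h₀ := absMonicPoly_pos hω n
    have h₁ := absMonicPoly_pos hω (n + 1)
    have h := hω (n + 1) n.succ_pos
    rw [absMonicPoly_add_two]
    positivity

theorem prod_sqrt_pos (hω : ∀ n, 1 ≤ n → 0 < ω n) (n : ℕ) :
    0 < ∏ k ∈ Finset.range n, √(ω (k + 1)) :=
  Finset.prod_pos fun k _ => Real.sqrt_pos.2 (hω _ k.succ_pos)

theorem absPoly_zero (ω : ℕ → ℝ) : absPoly ω 0 = 1 := by
  simp [absPoly, absMonicPoly]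

theorem absPoly_pos (hω : ∀ n, 1 ≤ n → 0 < ω n) (n : ℕ) : 0 < absPoly ω n :=
  div_pos (absMonicPoly_pos hω n) (prod_sqrt_pos hω n)

theorem christoffelSum_zero (ω : ℕ → ℝ) : christoffelSum ω 0 = 1 := by
  simp [christoffelSum, absPoly_zero]

theorem christoffelSum_succ (ω : ℕ → ℝ) (n : ℕ) :
    christoffelSum ω (n + 1) = christoffelSum ω n + absPoly ω (n + 1) ^ 2 :=
  Finset.sum_range_succ _ _

theorem christoffelSum_mono (ω : ℕ → ℝ) : Monotone (christoffelSum ω) :=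
  monotone_nat_of_le_succ fun n => by
    rw [christoffelSum_succ]; exact le_add_of_nonneg_right (sq_nonneg _)

theorem one_le_christoffelSum (ω : ℕ → ℝ) (n : ℕ) : 1 ≤ christoffelSum ω n :=
  christoffelSum_zero ω ▸ christoffelSum_mono ω n.zero_le

theorem christoffelSum_pos (ω : ℕ → ℝ) (n : ℕ) : 0 < christoffelSum ω n :=
  one_pos.trans_le (one_le_christoffelSum ω n)

theorem inv_christoffelSum_antitone (ω : ℕ → ℝ) : Antitone fun n => (christoffelSum ω n)⁻¹ :=
  fun m _ h => inv_anti₀ (christoffelSum_pos ω m) (christoffelSum_mono ω h)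

theorem inv_christoffelSum_nonneg (ω : ℕ → ℝ) (n : ℕ) : 0 ≤ (christoffelSum ω n)⁻¹ :=
  (inv_pos.2 (christoffelSum_pos ω n)).le

theorem exists_tendsto_inv_christoffelSum (ω : ℕ → ℝ) :
    ∃ s, 0 ≤ s ∧ Tendsto (fun n => (christoffelSum ω n)⁻¹) atTop (𝓝 s) := by
  have h := tendsto_atTop_ciInf (inv_christoffelSum_antitone ω)
    ⟨0, Set.forall_mem_range.2 (inv_christoffelSum_nonneg ω)⟩
  exact ⟨_, ge_of_tendsto' h (inv_christoffelSum_nonneg ω), h⟩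

theorem summable_absPoly_sq {s : ℝ} (hs : 0 < s)
    (h : Tendsto (fun n => (christoffelSum ω n)⁻¹) atTop (𝓝 s)) :
    Summable fun n => absPoly ω n ^ 2 := by
  refine summable_of_sum_range_le (c := s⁻¹) (fun _ => sq_nonneg _) fun n => ?_
  calc ∑ k ∈ Finset.range n, absPoly ω k ^ 2
      ≤ christoffelSum ω n := by
        rw [christoffelSum, Finset.sum_range_succ]; exact le_add_of_nonneg_right (sq_nonneg _)
    _ ≤ s⁻¹ := le_inv_of_le_inv₀ hs ((inv_christoffelSum_antitone ω).le_of_tendsto h n)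

/-- The Christoffel–Darboux formula at the conjugate points `i` and `-i`. -/
theorem christoffelSum_eq (hω : ∀ n, 1 ≤ n → 0 < ω n) (n : ℕ) :
    christoffelSum ω n = √(ω (n + 1)) * absPoly ω n * absPoly ω (n + 1) := by
  induction n with
  | zero =>
    have h := (Real.sqrt_pos.2 (hω 1 le_rfl)).ne'
    simp [christoffelSum_zero, absPoly, absMonicPoly, seqB, h]
  | succ n ih =>
    have hprod := (prod_sqrt_pos hω n).ne'
    have h₁ := (Real.sqrt_pos.2 (hω (n + 1) n.succ_pos)).ne'
    have h₂ := (Real.sqrt_pos.2 (hω (n + 2) (n + 1).succ_pos)).ne'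
    have hsq := Real.sq_sqrt (hω (n + 1) n.succ_pos).le
    rw [christoffelSum_succ, ih]
    simp only [absPoly, absMonicPoly_add_two ω n, Finset.prod_range_succ]
    field_simp
    rw [hsq]
    ring

theorem seqB_div_seqB (hω : ∀ n, 1 ≤ n → 0 < ω n) (n : ℕ) :
    seqB ω n / seqB ω (n + 1) = absPoly ω (n + 1) ^ 2 / christoffelSum ω (n + 1) := by
  have hprod := (prod_sqrt_pos hω (n + 1)).ne'
  have h₁ : seqB ω n ≠ 0 := (absMonicPoly_pos hω (n + 1)).ne'
  have h₂ : seqB ω (n + 1) ≠ 0 := (absMonicPoly_pos hω (n + 2)).ne'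
  have h := (Real.sqrt_pos.2 (hω (n + 2) (n + 1).succ_pos)).ne'
  rw [christoffelSum_eq hω]
  simp only [absPoly, absMonicPoly, Finset.prod_range_succ _ (n + 1)]
  field_simp

theorem one_sub_seqB_div_seqB (hω : ∀ n, 1 ≤ n → 0 < ω n) (n : ℕ) :
    1 - seqB ω n / seqB ω (n + 1) = christoffelSum ω n / christoffelSum ω (n + 1) := by
  rw [seqB_div_seqB hω, eq_div_iff (christoffelSum_pos ω _).ne', sub_mul,
    div_mul_cancel₀ _ (christoffelSum_pos ω _).ne', christoffelSum_succ]
  ring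

theorem prod_one_sub_seqB_div_seqB (hω : ∀ n, 1 ≤ n → 0 < ω n) (m : ℕ) :
    ∏ n ∈ Finset.range m, (1 - seqB ω n / seqB ω (n + 1)) = (christoffelSum ω m)⁻¹ := by
  induction m with
  | zero => simp [christoffelSum_zero]
  | succ m ih =>
    rw [Finset.prod_range_succ, ih, one_sub_seqB_div_seqB hω, ← div_eq_inv_mul, div_div_cancel_left'
      (christoffelSum_pos ω m).ne']

theorem pos_of_tendsto_sum_seqB_div_seqB (hω : ∀ n, 1 ≤ n → 0 < ω n) {s S : ℝ}
    (hs : Tendsto (fun n => (christoffelSum ω n)⁻¹) atTop (𝓝 s))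
    (hS : Tendsto (fun m => ∑ n ∈ Finset.range m, seqB ω n / seqB ω (n + 1)) atTop (𝓝 S)) :
    0 < s := by
  have hnonneg (n : ℕ) : 0 ≤ seqB ω n / seqB ω (n + 1) :=
    (div_pos (absMonicPoly_pos hω (n + 1)) (absMonicPoly_pos hω (n + 2))).le
  have hsummable : Summable fun n => ‖-(seqB ω n / seqB ω (n + 1))‖ := by
    simpa only [norm_neg] using ((hasSum_iff_tendsto_nat_of_nonneg hnonneg S).2 hS).summable.norm
  have hfactor (n : ℕ) : 1 + -(seqB ω n / seqB ω (n + 1)) ≠ 0 := by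
    rw [← sub_eq_add_neg, one_sub_seqB_div_seqB hω]
    exact (div_pos (christoffelSum_pos ω _) (christoffelSum_pos ω _)).ne'
  have hprod := (multipliable_one_add_of_summable hsummable).hasProd.tendsto_prod_nat
  simp only [← sub_eq_add_neg, prod_one_sub_seqB_div_seqB hω] at hprod
  rw [tendsto_nhds_unique hs hprod]
  refine lt_of_le_of_ne (ge_of_tendsto' hprod (inv_christoffelSum_nonneg ω)) (Ne.symm ?_)
  simpa only [← sub_eq_add_neg] using tprod_one_add_ne_zero_of_summable hfactor hsummable

end Sequences

section StarAlgebra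

theorem norm_mul_norm_le_two {𝕜 A : Type*} [NormedField 𝕜] [NonUnitalNormedRing A] [StarRing A]
    [CStarRing A] [NormedSpace 𝕜 A] {a : A} {c : 𝕜} (h : star a - a = c • (star a * a)) :
    ‖c‖ * ‖a‖ ≤ 2 := by
  rcases (norm_nonneg a).eq_or_lt with ha | ha
  · simp [← ha]
  · refine le_of_mul_le_mul_right ?_ ha
    calc ‖c‖ * ‖a‖ * ‖a‖ = ‖star a - a‖ := by
          rw [h, norm_smul, CStarRing.norm_star_mul_self, mul_assoc]
      _ ≤ ‖star a‖ + ‖a‖ := norm_sub_le _ _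
      _ = 2 * ‖a‖ := by rw [norm_star, two_mul]

variable {𝕜 A : Type*} [CommRing 𝕜] [StarRing 𝕜] [Ring A] [StarRing A] [Algebra 𝕜 A]
  [StarModule 𝕜 A] {a r : A} {z : 𝕜}

theorem star_sub_self_of_isSelfAdjoint (ha : IsSelfAdjoint a) (hr : (z • 1 - a) * r = 1) :
    star r - r = (z - star z) • (star r * r) := by
  have hr' : star r * (star z • 1 - a) = 1 := by simpa [ha.star_eq] using congrArg star hr
  calc star r - r = star r * ((z • 1 - a) * r) - star r * (star z • 1 - a) * r := by
        rw [hr, hr', mul_one, one_mul]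
    _ = (z - star z) • (star r * r) := by
        simp only [mul_sub, sub_mul, smul_mul_assoc, mul_smul_comm, one_mul, mul_one, sub_smul,
          mul_assoc]
        abel

theorem star_sub_self_of_isSelfAdjoint' (ha : IsSelfAdjoint a) (hr : r * (z • 1 - a) = 1) :
    star r - r = (z - star z) • (r * star r) := by
  have hr' : (star z • 1 - a) * star r = 1 := by simpa [ha.star_eq] using congrArg star hr
  have h := star_sub_self_of_isSelfAdjoint ha hr'
  rw [star_star, star_star] at h
  rw [← neg_sub r, h, ← neg_smul, neg_sub]

end StarAlgebra

section StrongConvergence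

variable {𝕜 E F : Type*} [NontriviallyNormedField 𝕜] [NormedAddCommGroup E] [NormedSpace 𝕜 E]
  [NormedAddCommGroup F] [NormedSpace 𝕜 F]

/-- The subspace of vectors `ξ` for which the sequence `A_m ξ` converges. -/
def convergenceSubmodule (A : ℕ → E →L[𝕜] F) : Submodule 𝕜 E where
  carrier := {ξ | ∃ η, Tendsto (fun m => A m ξ) atTop (𝓝 η)}
  add_mem' := fun ⟨_, hξ⟩ ⟨_, hη⟩ => ⟨_, by simpa using hξ.add hη⟩
  zero_mem' := ⟨0, by simp⟩
  smul_mem' := fun c _ ⟨_, hξ⟩ => ⟨_, by simpa using hξ.const_smul c⟩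

theorem isClosed_convergenceSubmodule [CompleteSpace F] {A : ℕ → E →L[𝕜] F} {C : ℝ}
    (hA : ∀ m, ‖A m‖ ≤ C) : IsClosed (convergenceSubmodule A : Set E) := by
  have hC : 0 ≤ C := (norm_nonneg _).trans (hA 0)
  refine isClosed_of_closure_subset fun ξ hξ => cauchySeq_tendsto_of_complete ?_
  refine Metric.cauchySeq_iff'.2 fun ε hε => ?_
  obtain ⟨ζ, ⟨η, hη⟩, hζ⟩ := Metric.mem_closure_iff.1 hξ (ε / 3 / (C + 1)) (by positivity)
  have approx (m : ℕ) : dist (A m ξ) (A m ζ) < ε / 3 := by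
    calc dist (A m ξ) (A m ζ) ≤ C * dist ξ ζ := by
          rw [dist_eq_norm, dist_eq_norm, ← map_sub]; exact (A m).le_of_opNorm_le (hA m) _
      _ ≤ (C + 1) * dist ξ ζ := by gcongr; exact (lt_add_one C).le
      _ < ε / 3 := by rwa [lt_div_iff₀' (by positivity)] at hζ
  obtain ⟨N, hN⟩ := Metric.cauchySeq_iff'.1 hη.cauchySeq (ε / 3) (by positivity)
  refine ⟨N, fun n hn => ?_⟩
  calc dist (A n ξ) (A N ξ)
      ≤ dist (A n ξ) (A n ζ) + dist (A n ζ) (A N ζ) + dist (A N ζ) (A N ξ) := dist_triangle4 _ _ _ _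
    _ < ε / 3 + ε / 3 + ε / 3 := by
        gcongr
        exacts [approx n, hN n hn, dist_comm (A N ζ) _ ▸ approx N]
    _ = ε := by ring

theorem exists_strongLimit_of_convergenceSubmodule_eq_top [CompleteSpace E] {A : ℕ → E →L[𝕜] F}
    (h : convergenceSubmodule A = ⊤) :
    ∃ Y : E →L[𝕜] F, ∀ ξ, Tendsto (fun m => A m ξ) atTop (𝓝 (Y ξ)) := by
  choose f hf using fun ξ => (h ▸ Submodule.mem_top : ξ ∈ convergenceSubmodule A)
  exact ⟨continuousLinearMapOfTendsto A (tendsto_pi_nhds.2 hf), hf⟩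

end StrongConvergence

section SelfAdjointExtensions

variable {𝕜 E : Type*} [RCLike 𝕜] [NormedAddCommGroup E] [InnerProductSpace 𝕜 E] [CompleteSpace E]

open scoped InnerProductSpace

theorem isSelfAdjoint_of_surjective_smul_sub {T : E →ₗ.[𝕜] E} {z : 𝕜}
    (hdense : Dense (T.domain : Set E)) (hT : T.IsFormalAdjoint T)
    (hz : ∀ ξ, ∃ x : T.domain, z • (x : E) - T x = ξ)
    (hz' : ∀ ξ, ∃ x : T.domain, star z • (x : E) - T x = ξ) : IsSelfAdjoint T := by
  have hle : T ≤ T.adjoint := hT.le_adjoint hdense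
  refine LinearPMap.isSelfAdjoint_def.2
    (LinearPMap.eq_of_le_of_domain_eq hle (le_antisymm hle.1 fun y hy => ?_)).symm
  obtain ⟨x, hx⟩ := hz (z • y - T.adjoint ⟨y, hy⟩)
  obtain ⟨w, hw⟩ := hz' (y - x)
  have hyx : y - x = 0 := by
    rw [← inner_self_eq_zero (𝕜 := 𝕜)]
    calc ⟪y - x, y - x⟫_𝕜 = ⟪y - x, star z • (w : E) - T w⟫_𝕜 := by rw [hw]
      _ = ⟪z • y - T.adjoint ⟨y, hy⟩, (w : E)⟫_𝕜 - ⟪z • (x : E) - T x, (w : E)⟫_𝕜 := by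
        simp only [inner_sub_left, inner_sub_right, inner_smul_left, inner_smul_right, hT x w,
          LinearPMap.adjoint_isFormalAdjoint hdense ⟨y, hy⟩ w, starRingEnd_apply]
        ring
      _ = 0 := by rw [hx, sub_self]
  rw [sub_eq_zero.1 hyx]
  exact x.2

/-- `Y` behaves like the resolvent `(z - T)⁻¹` of a self-adjoint extension `T` of `X`: it inverts
`z - X`, its adjoint inverts `z̄ - X`, and the resolvent identity between `Y` and its adjoint holds
in both orders. -/
structure IsExtensionResolvent (X : E →ₗ.[𝕜] E) (z : 𝕜) (Y : E →L[𝕜] E) : Prop where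
  apply_smul_sub : ∀ x : X.domain, Y (z • (x : E) - X x) = x
  star_apply_smul_sub : ∀ x : X.domain, star Y (star z • (x : E) - X x) = x
  star_sub_self : star Y - Y = (z - star z) • (star Y * Y)
  star_sub_self' : star Y - Y = (z - star z) • (Y * star Y)

/-- The restriction of `X*` to the image of `Y`. For the Jacobi operator it is, by definition,
`adjointOnImage`. -/
noncomputable def adjointRestrict (X : E →ₗ.[𝕜] E) (Y : E →L[𝕜] E) : E →ₗ.[𝕜] E :=
  X.adjoint.domRestrict (LinearMap.range (Y : E →ₗ[𝕜] E))

theorem inner_star_apply_left (Y : E →L[𝕜] E) (ξ η : E) : ⟪star Y ξ, η⟫_𝕜 = ⟪ξ, Y η⟫_𝕜 :=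
  ContinuousLinearMap.adjoint_inner_left Y η ξ

theorem inner_star_apply_right (Y : E →L[𝕜] E) (ξ η : E) : ⟪ξ, star Y η⟫_𝕜 = ⟪Y ξ, η⟫_𝕜 :=
  ContinuousLinearMap.adjoint_inner_right Y ξ η

namespace IsExtensionResolvent

variable {X : E →ₗ.[𝕜] E} {z : 𝕜} {Y : E →L[𝕜] E}

theorem inner_smul_sub (h : IsExtensionResolvent X z Y) (ξ : E) (x : X.domain) :
    ⟪z • Y ξ - ξ, (x : E)⟫_𝕜 = ⟪Y ξ, X x⟫_𝕜 := by
  calc ⟪z • Y ξ - ξ, (x : E)⟫_𝕜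
      = ⟪Y ξ, star z • (x : E)⟫_𝕜 - ⟪ξ, star Y (star z • (x : E) - X x)⟫_𝕜 := by
        rw [h.star_apply_smul_sub, inner_sub_left, inner_smul_left, inner_smul_right,
          starRingEnd_apply]
    _ = ⟪Y ξ, X x⟫_𝕜 := by rw [inner_star_apply_right, inner_sub_right, sub_sub_cancel]

theorem mem_adjoint_domain (h : IsExtensionResolvent X z Y) (ξ : E) : Y ξ ∈ X.adjoint.domain :=
  LinearPMap.mem_adjoint_domain_of_exists _ ⟨_, h.inner_smul_sub ξ⟩

theorem range_le_adjoint_domain (h : IsExtensionResolvent X z Y) :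
    LinearMap.range (Y : E →ₗ[𝕜] E) ≤ X.adjoint.domain := by
  rintro _ ⟨ξ, rfl⟩
  exact h.mem_adjoint_domain ξ

theorem apply_mem_domain_adjointRestrict (h : IsExtensionResolvent X z Y) (ξ : E) :
    Y ξ ∈ (adjointRestrict X Y).domain :=
  ⟨⟨ξ, rfl⟩, h.mem_adjoint_domain ξ⟩

theorem adjointRestrict_apply (hX : Dense (X.domain : Set E)) (h : IsExtensionResolvent X z Y)
    {ξ : E} {x : (adjointRestrict X Y).domain} (hx : (x : E) = Y ξ) :
    adjointRestrict X Y x = z • Y ξ - ξ :=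
  LinearPMap.adjoint_apply_eq hX _ fun w => by rw [h.inner_smul_sub ξ w, ← hx]; rfl

theorem exists_eq_apply_of_adjointRestrict (x : (adjointRestrict X Y).domain) :
    ∃ ξ, (x : E) = Y ξ := by
  obtain ⟨⟨ξ, hξ⟩, -⟩ := x.2
  exact ⟨ξ, hξ.symm⟩

theorem smul_sub_adjointRestrict (hX : Dense (X.domain : Set E)) (h : IsExtensionResolvent X z Y)
    (ξ : E) : z • Y ξ - adjointRestrict X Y ⟨Y ξ, h.apply_mem_domain_adjointRestrict ξ⟩ = ξ := by
  rw [h.adjointRestrict_apply hX rfl, sub_sub_cancel]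

theorem apply_smul_sub_adjointRestrict (hX : Dense (X.domain : Set E))
    (h : IsExtensionResolvent X z Y) (x : (adjointRestrict X Y).domain) :
    Y (z • (x : E) - adjointRestrict X Y x) = x := by
  obtain ⟨ξ, hξ⟩ := exists_eq_apply_of_adjointRestrict x
  rw [h.adjointRestrict_apply hX hξ, hξ, sub_sub_cancel]

theorem le_adjointRestrict (hX : Dense (X.domain : Set E)) (h : IsExtensionResolvent X z Y) :
    X ≤ adjointRestrict X Y := by
  refine ⟨fun x hx => ?_, fun x y hxy => ?_⟩
  · have hmem := h.apply_mem_domain_adjointRestrict (z • x - X ⟨x, hx⟩)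
    rwa [h.apply_smul_sub ⟨x, hx⟩] at hmem
  · have hy : (y : E) = Y (z • (x : E) - X x) := by rw [h.apply_smul_sub, hxy]
    rw [h.adjointRestrict_apply hX hy, h.apply_smul_sub, sub_sub_cancel]

theorem isFormalAdjoint_adjointRestrict (hX : Dense (X.domain : Set E))
    (h : IsExtensionResolvent X z Y) :
    (adjointRestrict X Y).IsFormalAdjoint (adjointRestrict X Y) := by
  intro x y
  obtain ⟨ξ, hξ⟩ := exists_eq_apply_of_adjointRestrict x
  obtain ⟨η, hη⟩ := exists_eq_apply_of_adjointRestrict y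
  have key : ⟪Y ξ, η⟫_𝕜 - ⟪ξ, Y η⟫_𝕜 = (z - star z) * ⟪Y ξ, Y η⟫_𝕜 := by
    rw [← inner_star_apply_right, ← inner_star_apply_right Y ξ, ← inner_sub_right,
      ← sub_apply, h.star_sub_self, smul_apply, inner_smul_right, mul_apply_eq_comp]
  rw [h.adjointRestrict_apply hX hξ, h.adjointRestrict_apply hX hη, hξ, hη, inner_sub_left,
    inner_sub_right, inner_smul_left, inner_smul_right, starRingEnd_apply]
  linear_combination key

theorem star_apply_eq (h : IsExtensionResolvent X z Y) (ξ : E) :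
    star Y ξ = Y (ξ + (z - star z) • star Y ξ) := by
  have hsub := congrArg (· ξ) h.star_sub_self'
  simp only [sub_apply, smul_apply, mul_apply_eq_comp] at hsub
  rw [map_add, map_smul, ← hsub, add_sub_cancel]

theorem isSelfAdjoint_adjointRestrict (hX : Dense (X.domain : Set E))
    (h : IsExtensionResolvent X z Y) : IsSelfAdjoint (adjointRestrict X Y) := by
  refine isSelfAdjoint_of_surjective_smul_sub (z := z) (hX.mono (h.le_adjointRestrict hX).1)
    (h.isFormalAdjoint_adjointRestrict hX)
    (fun ξ => ⟨⟨Y ξ, _⟩, h.smul_sub_adjointRestrict hX ξ⟩) fun ξ => ?_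
  have hmem : star Y ξ ∈ (adjointRestrict X Y).domain :=
    h.star_apply_eq ξ ▸ h.apply_mem_domain_adjointRestrict _
  refine ⟨⟨star Y ξ, hmem⟩, ?_⟩
  calc star z • star Y ξ - adjointRestrict X Y ⟨star Y ξ, hmem⟩
      = star z • star Y ξ - (z • star Y ξ - (ξ + (z - star z) • star Y ξ)) := by
        rw [h.adjointRestrict_apply hX (h.star_apply_eq ξ), ← h.star_apply_eq]
    _ = ξ := by rw [sub_smul]; abel

end IsExtensionResolvent

section Limits

variable {ι : Type*} {l : Filter ι} [l.NeBot] {A : ι → E →L[𝕜] E} {Y Z : E →L[𝕜] E}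

theorem eq_star_of_tendsto (hY : ∀ ξ, Tendsto (fun m => A m ξ) l (𝓝 (Y ξ)))
    (hZ : ∀ ξ, Tendsto (fun m => star (A m) ξ) l (𝓝 (Z ξ))) : Z = star Y := by
  refine ContinuousLinearMap.ext fun ξ => ext_inner_left 𝕜 fun η => ?_
  rw [inner_star_apply_right]
  refine tendsto_nhds_unique (tendsto_const_nhds.inner (hZ ξ))
    (((hY η).inner tendsto_const_nhds).congr fun m => ?_)
  rw [inner_star_apply_right]

theorem star_sub_self_of_tendsto {c : 𝕜} (hY : ∀ ξ, Tendsto (fun m => A m ξ) l (𝓝 (Y ξ)))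
    (hA : ∀ m, star (A m) - A m = c • (star (A m) * A m)) : star Y - Y = c • (star Y * Y) := by
  have expand (B : E →L[𝕜] E) (ξ η : E) : ⟪η, (star B - B) ξ⟫_𝕜 = ⟪B η, ξ⟫_𝕜 - ⟪η, B ξ⟫_𝕜 ∧
      ⟪η, (c • (star B * B)) ξ⟫_𝕜 = c * ⟪B η, B ξ⟫_𝕜 := by
    simp only [sub_apply, smul_apply, mul_apply_eq_comp, inner_sub_right, inner_smul_right,
      inner_star_apply_right, and_self]
  refine ContinuousLinearMap.ext fun ξ => ext_inner_left 𝕜 fun η => ?_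
  rw [(expand Y ξ η).1, (expand Y ξ η).2]
  refine tendsto_nhds_unique
    (((hY η).inner tendsto_const_nhds).sub (tendsto_const_nhds.inner (hY ξ)))
    ((((hY η).inner (hY ξ)).const_mul c).congr fun m => ?_)
  rw [← (expand (A m) ξ η).1, ← (expand (A m) ξ η).2, hA]

theorem star_sub_self_of_tendsto' {c : 𝕜} (hY : ∀ ξ, Tendsto (fun m => A m ξ) l (𝓝 (Y ξ)))
    (hZ : ∀ ξ, Tendsto (fun m => star (A m) ξ) l (𝓝 (Z ξ)))
    (hA : ∀ m, star (A m) - A m = c • (A m * star (A m))) : star Y - Y = c • (Y * star Y) := by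
  have h := star_sub_self_of_tendsto (c := -c) hZ fun m => by
    rw [star_star, neg_smul, ← hA, neg_sub]
  rwa [eq_star_of_tendsto hY hZ, star_star, neg_smul, ← neg_sub, neg_inj] at h

theorem isExtensionResolvent_of_tendsto {X : E →ₗ.[𝕜] E} {z : 𝕜}
    (hY : ∀ ξ, Tendsto (fun m => A m ξ) l (𝓝 (Y ξ)))
    (hZ : ∀ ξ, Tendsto (fun m => star (A m) ξ) l (𝓝 (Z ξ)))
    (hA : ∀ m, star (A m) - A m = (z - star z) • (star (A m) * A m))
    (hA' : ∀ m, star (A m) - A m = (z - star z) • (A m * star (A m)))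
    (hX : ∀ x : X.domain, ∀ᶠ m in l, A m (z • (x : E) - X x) = x)
    (hX' : ∀ x : X.domain, ∀ᶠ m in l, star (A m) (star z • (x : E) - X x) = x) :
    IsExtensionResolvent X z Y where
  apply_smul_sub x := tendsto_nhds_unique (hY _) (tendsto_nhds_of_eventually_eq (hX x))
  star_apply_smul_sub x := eq_star_of_tendsto hY hZ ▸
    tendsto_nhds_unique (hZ _) (tendsto_nhds_of_eventually_eq (hX' x))
  star_sub_self := star_sub_self_of_tendsto hY hA
  star_sub_self' := star_sub_self_of_tendsto' hY hZ hA'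

end Limits

end SelfAdjointExtensions

section MatrixOperators

variable {𝕜 E ι : Type*} [RCLike 𝕜] [NormedAddCommGroup E] [InnerProductSpace 𝕜 E] [Fintype ι]

open scoped Matrix

/-- The operator `∑ A_{lk} ⟨v_k, ·⟩ v_l`. For an orthonormal family `v` it acts by the matrix `A` on
the span of `v` and vanishes on the orthogonal complement. -/
noncomputable def matrixOperator (v : ι → E) (A : Matrix ι ι 𝕜) : E →L[𝕜] E :=
  ∑ l, ∑ k, A l k • InnerProductSpace.rankOne 𝕜 (v l) (v k)

theorem matrixOperator_apply (v : ι → E) (A : Matrix ι ι 𝕜) (ξ : E) :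
    matrixOperator v A ξ = ∑ l, (A *ᵥ fun k => inner 𝕜 (v k) ξ) l • v l := by
  simp [matrixOperator, Matrix.mulVec, dotProduct, Finset.sum_smul, mul_smul]

theorem matrixOperator_mul {v : ι → E} (hv : Orthonormal 𝕜 v) (A B : Matrix ι ι 𝕜) :
    matrixOperator v (A * B) = matrixOperator v A * matrixOperator v B := by
  refine ContinuousLinearMap.ext fun ξ => ?_
  simp_rw [mul_apply_eq_comp, matrixOperator_apply, hv.inner_right_fintype, Matrix.mulVec_mulVec]

/-- The non-unital `*`-homomorphism from matrices to operators given by an orthonormal family. -/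
noncomputable def matrixOperatorHom [CompleteSpace E] {v : ι → E} (hv : Orthonormal 𝕜 v) :
    Matrix ι ι 𝕜 →⋆ₙₐ[𝕜] (E →L[𝕜] E) where
  toFun := matrixOperator v
  map_smul' c A := by simp [matrixOperator, Finset.smul_sum, mul_smul]
  map_zero' := by simp [matrixOperator]
  map_add' A B := by simp [matrixOperator, add_smul, Finset.sum_add_distrib]
  map_mul' := matrixOperator_mul hv
  map_star' A := by
    simp only [matrixOperator, star_sum, star_smul, Matrix.star_apply,
      ContinuousLinearMap.star_eq_adjoint, InnerProductSpace.adjoint_rankOne]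
    exact Finset.sum_comm

theorem isUnit_smul_one_sub_of_isHermitian [DecidableEq ι] {A : Matrix ι ι 𝕜} (hA : A.IsHermitian)
    {z : 𝕜} (hz : star z ≠ z) : IsUnit (z • (1 : Matrix ι ι 𝕜) - A) := by
  by_contra hnot
  have hspec : z ∈ spectrum 𝕜 A := by rwa [spectrum.mem_iff, Algebra.algebraMap_eq_smul_one]
  rw [hA.spectrum_eq_image_range] at hspec
  obtain ⟨x, -, rfl⟩ := hspec
  exact hz (RCLike.conj_ofReal x)

end MatrixOperators

section EllTwo

theorem exists_lp_tendsto_of_dominated {ι α : Type*} {l : Filter ι} [l.NeBot] {p : ENNReal}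
    [Fact (1 ≤ p)] (hp : p ≠ ⊤) {F : α → Type*} [∀ i, NormedAddCommGroup (F i)] {f : ι → lp F p}
    {g : ∀ i, F i} {bound : α → ℝ} (hbound : Summable fun i => bound i ^ p.toReal)
    (hf : ∀ m i, ‖f m i‖ ≤ bound i) (hlim : ∀ i, Tendsto (fun m => f m i) l (𝓝 (g i))) :
    ∃ G : lp F p, Tendsto f l (𝓝 G) := by
  have hp₀ : 0 < p.toReal := ENNReal.toReal_pos (one_pos.trans_le Fact.out).ne' hp
  have hg (i : α) : ‖g i‖ ≤ bound i := le_of_tendsto' (hlim i).norm fun m => hf m i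
  have hmem : Memℓp g p := memℓp_gen <| hbound.of_nonneg_of_le (fun i => by positivity) fun i =>
    Real.rpow_le_rpow (norm_nonneg _) (hg i) hp₀.le
  refine ⟨⟨g, hmem⟩, tendsto_iff_norm_sub_tendsto_zero.2 ?_⟩
  have hsum : Tendsto (fun m => ∑' i, ‖f m i - g i‖ ^ p.toReal) l (𝓝 (∑' _ : α, 0)) := by
    refine tendsto_tsum_of_dominated_convergence (hbound.mul_left (2 ^ p.toReal)) (fun i => ?_)
      (Eventually.of_forall fun m i => ?_)
    · simpa [hp₀.ne'] using (((hlim i).sub_const (g i)).norm.rpow_const (Or.inr hp₀.le))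
    · have hbi : 0 ≤ bound i := (norm_nonneg _).trans (hg i)
      rw [Real.norm_of_nonneg (by positivity), ← Real.mul_rpow two_pos.le hbi]
      gcongr
      linarith [norm_sub_le (f m i) (g i), hf m i, hg i]
  have hnorm := hsum.rpow_const (p := 1 / p.toReal) (Or.inr (by positivity))
  rw [tsum_zero, Real.zero_rpow (by positivity)] at hnorm
  exact hnorm.congr fun m => (lp.norm_eq_tsum_rpow hp₀ _).symm

theorem delta_apply (k l : ℕ) : (delta k : ℕ → ℂ) l = if l = k then 1 else 0 := by
  simp [delta, lp.single_apply, Pi.single_apply]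

theorem star_delta (k : ℕ) : star (delta k) = delta k := by
  refine lp.ext (funext fun l => ?_)
  rw [lp.coeFn_star, Pi.star_apply, delta_apply, apply_ite star, star_one, star_zero]

theorem inner_delta (k : ℕ) (ξ : EllTwo) : inner ℂ (delta k) ξ = ξ k := by
  simp [delta, lp.inner_single_left]

theorem orthonormal_delta : Orthonormal ℂ delta :=
  orthonormal_iff_ite.2 fun k l => by rw [inner_delta, delta_apply]

theorem eq_top_of_isClosed_of_delta_mem {S : Submodule ℂ EllTwo} (hS : IsClosed (S : Set EllTwo))
    (hdelta : ∀ k, delta k ∈ S) : S = ⊤ := by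
  refine (Submodule.eq_top_iff'.2 fun ξ => ?_)
  refine hS.mem_of_tendsto (lp.hasSum_single (by norm_num) ξ) (Eventually.of_forall fun s => ?_)
  refine S.sum_mem fun k _ => ?_
  have hsingle : lp.single 2 k (ξ k) = ξ k • delta k := by
    rw [delta, ← lp.single_smul, smul_eq_mul, mul_one]
  exact hsingle ▸ S.smul_mem _ (hdelta k)

theorem delta_mem_finSupp (k : ℕ) : delta k ∈ finSupp :=
  (Set.finite_singleton k).subset fun l hl => by
    by_contra h
    exact hl ((delta_apply k l).trans (if_neg h))

theorem dense_finSupp : Dense (finSupp : Set EllTwo) := by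
  rw [Submodule.dense_iff_topologicalClosure_eq_top]
  exact eq_top_of_isClosed_of_delta_mem finSupp.isClosed_topologicalClosure fun k =>
    finSupp.le_topologicalClosure (delta_mem_finSupp k)

theorem eventually_apply_eq_zero {x : EllTwo} (hx : x ∈ finSupp) :
    ∀ᶠ m : ℕ in atTop, ∀ k, m ≤ k → x k = 0 := by
  obtain ⟨N, hN⟩ := Set.Finite.bddAbove hx
  filter_upwards [eventually_gt_atTop N] with m hm k hk
  by_contra h
  exact absurd (hN h) (by omega)

end EllTwo

section JacobiOperator

variable {ω : ℕ → ℝ}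

theorem jacobiOp_delta_zero (ω : ℕ → ℝ) :
    jacobiOp ω ⟨delta 0, delta_mem_finSupp 0⟩ = (√(ω 1) : ℂ) • delta 1 := by
  refine lp.ext (funext fun n => ?_)
  change jacobiAction ω (delta 0) n = (√(ω 1) : ℂ) * delta 1 n
  cases n <;> simp +contextual [jacobiAction, delta_apply]

theorem jacobiOp_delta_succ (ω : ℕ → ℝ) (k : ℕ) :
    jacobiOp ω ⟨delta (k + 1), delta_mem_finSupp (k + 1)⟩ =
      (√(ω (k + 1)) : ℂ) • delta k + (√(ω (k + 2)) : ℂ) • delta (k + 2) := by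
  refine lp.ext (funext fun n => ?_)
  change jacobiAction ω (delta (k + 1)) n =
    (√(ω (k + 1)) : ℂ) * delta k n + (√(ω (k + 2)) : ℂ) * delta (k + 2) n
  cases n <;> simp only [jacobiAction, delta_apply]
  all_goals grind

theorem delta_mem_of_jacobiOp_invariant (hω : ∀ n, 1 ≤ n → 0 < ω n) {S : Submodule ℂ EllTwo}
    (h₀ : delta 0 ∈ S) (hS : ∀ x : (jacobiOp ω).domain, (x : EllTwo) ∈ S → jacobiOp ω x ∈ S) :
    ∀ k, delta k ∈ S := by
  have hsqrt (n : ℕ) : (√(ω (n + 1)) : ℂ) ≠ 0 := by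
    exact_mod_cast (Real.sqrt_pos.2 (hω (n + 1) n.succ_pos)).ne'
  suffices h : ∀ k, delta k ∈ S ∧ delta (k + 1) ∈ S from fun k => (h k).1
  intro k
  induction k with
  | zero =>
    have h := hS ⟨delta 0, delta_mem_finSupp 0⟩ h₀
    rw [jacobiOp_delta_zero] at h
    exact ⟨h₀, (S.smul_mem_iff (hsqrt 0)).1 h⟩
  | succ k ih =>
    have h := hS ⟨delta (k + 1), delta_mem_finSupp (k + 1)⟩ ih.2
    rw [jacobiOp_delta_succ, S.add_mem_iff_right (S.smul_mem _ ih.1)] at h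
    exact ⟨ih.2, (S.smul_mem_iff (hsqrt (k + 1))).1 h⟩

end JacobiOperator

section Truncations

variable {ω : ℕ → ℝ} {m : ℕ}

open scoped Matrix

theorem orthonormal_delta_fin (m : ℕ) : Orthonormal ℂ fun k : Fin (m + 1) => delta k :=
  orthonormal_delta.comp _ Fin.val_injective

/-- The operator on `ℓ₂(ℕ)` acting by the matrix `A` on the span of `δ_0, …, δ_m` and vanishing on
the orthogonal complement. -/
noncomputable def deltaOperator (m : ℕ) :
    Matrix (Fin (m + 1)) (Fin (m + 1)) ℂ →⋆ₙₐ[ℂ] (EllTwo →L[ℂ] EllTwo) :=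
  matrixOperatorHom (orthonormal_delta_fin m)

theorem deltaOperator_apply (A : Matrix (Fin (m + 1)) (Fin (m + 1)) ℂ) (ξ : EllTwo) :
    deltaOperator m A ξ = ∑ l : Fin (m + 1), (A *ᵥ fun k => ξ k) l • delta l := by
  simp_rw [← inner_delta]
  exact matrixOperator_apply _ A ξ

theorem truncResolvent_eq_deltaOperator (ω : ℕ → ℝ) (m : ℕ) :
    truncResolvent ω m = deltaOperator m (truncResolventMatrix ω m) := rfl

theorem coe_deltaOperator_apply {A : Matrix (Fin (m + 1)) (Fin (m + 1)) ℂ} {ξ : EllTwo}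
    {v : ℕ → ℂ} (hA : ∀ l : Fin (m + 1), (A *ᵥ fun k => ξ k) l = v l)
    (hv : ∀ k, m < k → v k = 0) : ⇑(deltaOperator m A ξ) = v := by
  funext k
  simp_rw [deltaOperator_apply, hA, Fin.sum_univ_eq_sum_range (fun l => v l • delta l)]
  simp only [lp.coeFn_sum, lp.coeFn_smul, Finset.sum_apply, Pi.smul_apply, delta_apply,
    smul_eq_mul, mul_ite, mul_one, mul_zero, Finset.sum_ite_eq, Finset.mem_range]
  split_ifs with hk
  · rfl
  · exact (hv k (by omega)).symm

theorem deltaOperator_one_apply {ξ : EllTwo} (hξ : ∀ k, m < k → ξ k = 0) :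
    deltaOperator m 1 ξ = ξ :=
  lp.ext (coe_deltaOperator_apply (fun l => by rw [Matrix.one_mulVec]) hξ)

theorem isHermitian_truncMatrix (ω : ℕ → ℝ) (m : ℕ) : (truncMatrix ω m).IsHermitian := by
  ext l k
  simp only [truncMatrix, Matrix.conjTranspose_apply, Matrix.of_apply]
  split_ifs <;> first | omega | simp

theorem transpose_truncMatrix (ω : ℕ → ℝ) (m : ℕ) : (truncMatrix ω m)ᵀ = truncMatrix ω m := by
  ext l k
  simp only [truncMatrix, Matrix.transpose_apply, Matrix.of_apply]
  split_ifs <;> first | omega | rfl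

theorem truncMatrix_mulVec (v : ℕ → ℂ) (hv : v (m + 1) = 0) (l : Fin (m + 1)) :
    (truncMatrix ω m *ᵥ fun k => v k) l = jacobiAction ω v l := by
  obtain ⟨l, hl⟩ := l
  have hentry (k : Fin (m + 1)) : truncMatrix ω m ⟨l, hl⟩ k * v k =
      (if l + 1 = k then (√(ω k) : ℂ) * v k else 0) +
        if k + 1 = l then (√(ω l) : ℂ) * v k else 0 := by
    simp only [truncMatrix, Matrix.of_apply]
    split_ifs <;> first | omega | simp
  have hupper : (if l + 1 ∈ Finset.range (m + 1) then (√(ω (l + 1)) : ℂ) * v (l + 1) else 0) =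
      (√(ω (l + 1)) : ℂ) * v (l + 1) := by
    refine ite_eq_left_iff.2 fun h => ?_
    rw [show l + 1 = m + 1 by rw [Finset.mem_range] at h; omega, hv, mul_zero]
  rw [Matrix.mulVec, dotProduct, Finset.sum_congr rfl fun k _ => hentry k,
    Fin.sum_univ_eq_sum_range fun k : ℕ => (if l + 1 = k then (√(ω k) : ℂ) * v k else 0) +
      if k + 1 = l then (√(ω l) : ℂ) * v k else 0,
    Finset.sum_add_distrib, Finset.sum_ite_eq, hupper]
  cases l with
  | zero => simp [jacobiAction]
  | succ n =>
    simp only [jacobiAction, Nat.add_right_cancel_iff, Finset.sum_ite_eq', Finset.mem_range]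
    rw [if_pos (by omega), add_comm]

theorem deltaOperator_truncMatrix_apply {x : (jacobiOp ω).domain}
    (hx : ∀ k, m ≤ k → (x : EllTwo) k = 0) :
    deltaOperator m (truncMatrix ω m) x = jacobiOp ω x := by
  refine lp.ext (coe_deltaOperator_apply (truncMatrix_mulVec _ (hx _ m.le_succ)) fun k hk => ?_)
  obtain ⟨k, rfl⟩ := Nat.exists_eq_succ_of_ne_zero (Nat.ne_zero_of_lt hk)
  change jacobiAction ω x (k + 1) = 0
  rw [jacobiAction, hx k (by omega), hx (k + 2) (by omega), mul_zero, mul_zero, add_zero]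

theorem isFormalAdjoint_jacobiOp (ω : ℕ → ℝ) : (jacobiOp ω).IsFormalAdjoint (jacobiOp ω) := by
  intro x y
  obtain ⟨m, hx, hy⟩ := ((eventually_apply_eq_zero x.2).and (eventually_apply_eq_zero y.2)).exists
  have hstar : star (deltaOperator m (truncMatrix ω m)) = deltaOperator m (truncMatrix ω m) := by
    rw [← map_star]
    exact congrArg _ (isHermitian_truncMatrix ω m)
  rw [← deltaOperator_truncMatrix_apply hx, ← deltaOperator_truncMatrix_apply hy,
    ← inner_star_apply_left, hstar]

theorem deltaOperator_smul_sub_jacobiOp {A : Matrix (Fin (m + 1)) (Fin (m + 1)) ℂ} {z : ℂ}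
    (hA : A * (z • 1 - truncMatrix ω m) = 1) {x : (jacobiOp ω).domain}
    (hx : ∀ k, m ≤ k → (x : EllTwo) k = 0) :
    deltaOperator m A (z • (x : EllTwo) - jacobiOp ω x) = x := by
  have hone : deltaOperator m 1 (x : EllTwo) = x := deltaOperator_one_apply fun k hk => hx k hk.le
  calc deltaOperator m A (z • (x : EllTwo) - jacobiOp ω x)
      = deltaOperator m A (deltaOperator m (z • 1 - truncMatrix ω m) x) := by
        rw [map_sub (deltaOperator m), map_smul (deltaOperator m), sub_apply, smul_apply,
          hone, deltaOperator_truncMatrix_apply hx]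
    _ = x := by rw [← mul_apply_eq_comp, ← map_mul, hA, hone]

theorem isUnit_I_smul_one_sub_truncMatrix (ω : ℕ → ℝ) (m : ℕ) :
    IsUnit (Complex.I • (1 : Matrix (Fin (m + 1)) (Fin (m + 1)) ℂ) - truncMatrix ω m) :=
  isUnit_smul_one_sub_of_isHermitian (isHermitian_truncMatrix ω m) (by norm_num [Complex.ext_iff])

theorem truncResolventMatrix_mul (ω : ℕ → ℝ) (m : ℕ) :
    truncResolventMatrix ω m * (Complex.I • 1 - truncMatrix ω m) = 1 :=
  Matrix.nonsing_inv_mul _ <|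
    (Matrix.isUnit_iff_isUnit_det _).1 (isUnit_I_smul_one_sub_truncMatrix ω m)

theorem mul_truncResolventMatrix (ω : ℕ → ℝ) (m : ℕ) :
    (Complex.I • 1 - truncMatrix ω m) * truncResolventMatrix ω m = 1 :=
  Matrix.mul_nonsing_inv _ <|
    (Matrix.isUnit_iff_isUnit_det _).1 (isUnit_I_smul_one_sub_truncMatrix ω m)

theorem transpose_truncResolventMatrix (ω : ℕ → ℝ) (m : ℕ) :
    (truncResolventMatrix ω m)ᵀ = truncResolventMatrix ω m := by
  rw [truncResolventMatrix, Matrix.transpose_nonsing_inv, Matrix.transpose_sub,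
    Matrix.transpose_smul, Matrix.transpose_one, transpose_truncMatrix]

theorem star_truncResolventMatrix_mul (ω : ℕ → ℝ) (m : ℕ) :
    star (truncResolventMatrix ω m) * (star Complex.I • 1 - truncMatrix ω m) = 1 := by
  have h := congrArg star (mul_truncResolventMatrix ω m)
  rwa [star_mul, star_sub, star_smul, star_one, Matrix.star_eq_conjTranspose (truncMatrix ω m),
    isHermitian_truncMatrix ω m] at h

theorem star_truncResolvent_sub_self (ω : ℕ → ℝ) (m : ℕ) :
    star (truncResolvent ω m) - truncResolvent ω m =
      (Complex.I - star Complex.I) • (star (truncResolvent ω m) * truncResolvent ω m) := by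
  simp only [truncResolvent_eq_deltaOperator, ← map_star, ← map_sub, ← map_mul, ← map_smul]
  exact congrArg _ <| star_sub_self_of_isSelfAdjoint
    (isHermitian_truncMatrix ω m).isSelfAdjoint (mul_truncResolventMatrix ω m)

theorem star_truncResolvent_sub_self' (ω : ℕ → ℝ) (m : ℕ) :
    star (truncResolvent ω m) - truncResolvent ω m =
      (Complex.I - star Complex.I) • (truncResolvent ω m * star (truncResolvent ω m)) := by
  simp only [truncResolvent_eq_deltaOperator, ← map_star, ← map_sub, ← map_mul, ← map_smul]
  exact congrArg _ <| star_sub_self_of_isSelfAdjoint'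
    (isHermitian_truncMatrix ω m).isSelfAdjoint (truncResolventMatrix_mul ω m)

theorem norm_truncResolvent_le_one (ω : ℕ → ℝ) (m : ℕ) : ‖truncResolvent ω m‖ ≤ 1 := by
  have hnorm : ‖Complex.I - star Complex.I‖ = 2 := by
    rw [Complex.star_def, Complex.conj_I, sub_neg_eq_add, ← two_mul]
    simp
  have h := norm_mul_norm_le_two (star_truncResolvent_sub_self ω m)
  rw [hnorm] at h
  linarith

theorem eventually_truncResolvent_smul_sub (x : (jacobiOp ω).domain) :
    ∀ᶠ m in atTop, truncResolvent ω m (Complex.I • (x : EllTwo) - jacobiOp ω x) = x :=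
  (eventually_apply_eq_zero x.2).mono fun m hx =>
    deltaOperator_smul_sub_jacobiOp (truncResolventMatrix_mul ω m) hx

theorem eventually_star_truncResolvent_smul_sub (x : (jacobiOp ω).domain) :
    ∀ᶠ m in atTop,
      star (truncResolvent ω m) (star Complex.I • (x : EllTwo) - jacobiOp ω x) = x := by
  refine (eventually_apply_eq_zero x.2).mono fun m hx => ?_
  rw [truncResolvent_eq_deltaOperator, ← map_star]
  exact deltaOperator_smul_sub_jacobiOp (star_truncResolventMatrix_mul ω m) hx

end Truncations

section FirstColumn

variable {ω : ℕ → ℝ} {m : ℕ}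

open scoped Matrix

/-- The modulus of the `l`-th coordinate of `(i - X_m)⁻¹ δ_0`. -/
noncomputable def columnModulus (ω : ℕ → ℝ) (m l : ℕ) : ℝ :=
  absPoly ω l * alternatingTail (fun j => (christoffelSum ω j)⁻¹) m l

/-- The column `(i - X_m)⁻¹ δ_0`, extended by `0`. -/
noncomputable def resolventColumn (ω : ℕ → ℝ) (m l : ℕ) : ℂ :=
  (-Complex.I) ^ (l + 1) * columnModulus ω m l

theorem columnModulus_of_lt {l : ℕ} (h : m < l) : columnModulus ω m l = 0 := by
  rw [columnModulus, alternatingTail_of_lt h, mul_zero]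

theorem abs_columnModulus_le (hω : ∀ n, 1 ≤ n → 0 < ω n) (m l : ℕ) :
    |columnModulus ω m l| ≤ absPoly ω l := by
  have hp := (absPoly_pos hω l).le
  have ht := alternatingTail_mem_Icc (inv_christoffelSum_antitone ω)
    (inv_christoffelSum_nonneg ω) m l
  rw [columnModulus, abs_of_nonneg (mul_nonneg hp ht.1)]
  exact mul_le_of_le_one_right hp (ht.2.trans (inv_le_one_of_one_le₀ (one_le_christoffelSum ω l)))

theorem columnModulus_zero_add (hω : ∀ n, 1 ≤ n → 0 < ω n) (m : ℕ) :
    columnModulus ω m 0 + √(ω 1) * columnModulus ω m 1 = 1 := by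
  have ht := alternatingTail_add_succ (a := fun j => (christoffelSum ω j)⁻¹) m.zero_le
  have hS := christoffelSum_eq hω 0
  simp only [christoffelSum_zero, absPoly_zero, inv_one, zero_add, mul_one] at ht hS
  rw [columnModulus, columnModulus, absPoly_zero, one_mul, ← mul_assoc, ← hS, one_mul, ht]

theorem sqrt_mul_columnModulus (hω : ∀ n, 1 ≤ n → 0 < ω n) {n : ℕ} (h : n < m) :
    √(ω (n + 1)) * columnModulus ω m n =
      columnModulus ω m (n + 1) + √(ω (n + 2)) * columnModulus ω m (n + 2) := by
  refine mul_left_cancel₀ (absPoly_pos hω (n + 1)).ne' ?_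
  have ht (k : ℕ) (hk : k ≤ m) := mul_eq_one_iff_eq_inv₀ (christoffelSum_pos ω k).ne' |>.2
    (alternatingTail_add_succ (a := fun j => (christoffelSum ω j)⁻¹) hk)
  simp only [columnModulus]
  linear_combination ht n h.le - ht (n + 1) h -
    alternatingTail (fun j => (christoffelSum ω j)⁻¹) m n * christoffelSum_eq hω n +
    alternatingTail (fun j => (christoffelSum ω j)⁻¹) m (n + 2) * christoffelSum_eq hω (n + 1) +
    alternatingTail (fun j => (christoffelSum ω j)⁻¹) m (n + 1) * christoffelSum_succ ω n

theorem I_mul_resolventColumn_sub_jacobiAction (hω : ∀ n, 1 ≤ n → 0 < ω n) {l : ℕ} (h : l ≤ m) :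
    Complex.I * resolventColumn ω m l - jacobiAction ω (resolventColumn ω m) l =
      if l = 0 then 1 else 0 := by
  cases l with
  | zero =>
    have hx := congrArg ((↑) : ℝ → ℂ) (columnModulus_zero_add hω m)
    push_cast at hx
    simp only [jacobiAction, resolventColumn, if_true]
    linear_combination hx - (columnModulus ω m 0 + √(ω 1) * columnModulus ω m 1) * Complex.I_sq
  | succ n =>
    have hx := congrArg ((↑) : ℝ → ℂ) (sqrt_mul_columnModulus hω h)
    push_cast at hx
    simp only [jacobiAction, resolventColumn, if_neg n.succ_ne_zero]
    linear_combination (-Complex.I) ^ (n + 1) * (-hx - (columnModulus ω m (n + 1) +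
      √(ω (n + 2)) * columnModulus ω m (n + 2)) * Complex.I_sq)

theorem I_smul_one_sub_truncMatrix_mulVec_resolventColumn (hω : ∀ n, 1 ≤ n → 0 < ω n) (m : ℕ) :
    ((Complex.I • 1 - truncMatrix ω m) *ᵥ fun k : Fin (m + 1) => resolventColumn ω m k) =
      Pi.single 0 1 := by
  funext l
  have hlast : resolventColumn ω m (m + 1) = 0 := by
    rw [resolventColumn, columnModulus_of_lt m.lt_succ_self, Complex.ofReal_zero, mul_zero]
  rw [Matrix.sub_mulVec, Matrix.smul_mulVec, Matrix.one_mulVec, Pi.sub_apply,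
    truncMatrix_mulVec _ hlast, Pi.smul_apply, smul_eq_mul,
    I_mul_resolventColumn_sub_jacobiAction hω (Nat.lt_succ_iff.1 l.2), Pi.single_apply]
  simp only [Fin.val_eq_zero_iff]

theorem truncResolventMatrix_mulVec_single_zero (hω : ∀ n, 1 ≤ n → 0 < ω n) (m : ℕ) :
    truncResolventMatrix ω m *ᵥ Pi.single 0 1 =
      fun k : Fin (m + 1) => resolventColumn ω m k := by
  rw [← I_smul_one_sub_truncMatrix_mulVec_resolventColumn hω, Matrix.mulVec_mulVec,
    truncResolventMatrix_mul, Matrix.one_mulVec]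

theorem truncStieltjes_eq (hω : ∀ n, 1 ≤ n → 0 < ω n) (m : ℕ) : truncStieltjes ω m =
    -Complex.I * (∑ j ∈ Finset.range (m + 1), (-1) ^ j * (christoffelSum ω j)⁻¹ : ℝ) := by
  have h := congrFun (truncResolventMatrix_mulVec_single_zero hω m) 0
  rw [Matrix.mulVec_single_one] at h
  rw [← alternatingTail_zero_right (a := fun j => (christoffelSum ω j)⁻¹)]
  exact h.trans (by simp [resolventColumn, columnModulus, absPoly_zero])

theorem delta_zero_comp_val (m : ℕ) : (fun k : Fin (m + 1) => delta 0 k) = Pi.single 0 1 := by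
  funext k
  simp [delta_apply, Pi.single_apply]

theorem coe_truncResolvent_delta_zero (hω : ∀ n, 1 ≤ n → 0 < ω n) (m : ℕ) :
    ⇑(truncResolvent ω m (delta 0)) = resolventColumn ω m := by
  refine coe_deltaOperator_apply (fun l => ?_) fun k hk => ?_
  · rw [delta_zero_comp_val, truncResolventMatrix_mulVec_single_zero hω]
  · rw [resolventColumn, columnModulus_of_lt hk, Complex.ofReal_zero, mul_zero]

theorem star_truncResolvent_delta_zero (ω : ℕ → ℝ) (m : ℕ) :
    star (truncResolvent ω m) (delta 0) = star (truncResolvent ω m (delta 0)) := by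
  have hstar (l : Fin (m + 1)) : star (truncResolventMatrix ω m) l 0 =
      star (truncResolventMatrix ω m l 0) := by
    rw [Matrix.star_apply]
    exact congrArg star (congrFun₂ (transpose_truncResolventMatrix ω m) l 0)
  rw [truncResolvent_eq_deltaOperator, ← map_star]
  simp_rw [deltaOperator_apply, delta_zero_comp_val, Matrix.mulVec_single_one, Matrix.col_apply,
    hstar, star_sum, star_smul, star_delta]

end FirstColumn

section StrongLimits

variable {ω : ℕ → ℝ}

theorem apply_mem_convergenceSubmodule {𝕜 E : Type*} [NontriviallyNormedField 𝕜]
    [NormedAddCommGroup E] [NormedSpace 𝕜 E] {X : E →ₗ.[𝕜] E} {A : ℕ → E →L[𝕜] E} {z : 𝕜}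
    (hA : ∀ x : X.domain, ∀ᶠ n in atTop, A n (z • (x : E) - X x) = x) {x : X.domain}
    (hx : (x : E) ∈ convergenceSubmodule A) : X x ∈ convergenceSubmodule A := by
  have hmem : z • (x : E) - X x ∈ convergenceSubmodule A :=
    ⟨x, tendsto_nhds_of_eventually_eq (hA x)⟩
  rw [← sub_sub_cancel (z • (x : E)) (X x)]
  exact Submodule.sub_mem _ (Submodule.smul_mem _ z hx) hmem

theorem exists_isStrongLimit_of_tendsto_delta_zero (hω : ∀ n, 1 ≤ n → 0 < ω n)
    {A : ℕ → EllTwo →L[ℂ] EllTwo} {C : ℝ} {z : ℂ} {η : EllTwo} (hC : ∀ n, ‖A n‖ ≤ C)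
    (hA : ∀ x : (jacobiOp ω).domain, ∀ᶠ n in atTop, A n (z • (x : EllTwo) - jacobiOp ω x) = x)
    (hη : Tendsto (fun n => A n (delta 0)) atTop (𝓝 η)) : ∃ Y, IsStrongLimit A Y :=
  exists_strongLimit_of_convergenceSubmodule_eq_top <|
    eq_top_of_isClosed_of_delta_mem (isClosed_convergenceSubmodule hC) <|
      delta_mem_of_jacobiOp_invariant hω ⟨η, hη⟩ fun _ => apply_mem_convergenceSubmodule hA

variable {σ : ℕ → ℕ} {t : ℝ}

theorem exists_tendsto_truncResolvent_delta_zero (hω : ∀ n, 1 ≤ n → 0 < ω n)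
    (hp : Summable fun l => absPoly ω l ^ 2) (hσ : Tendsto σ atTop atTop)
    (ht : Tendsto (fun n => ∑ j ∈ Finset.range (σ n + 1), (-1) ^ j * (christoffelSum ω j)⁻¹)
      atTop (𝓝 t)) :
    ∃ η, Tendsto (fun n => truncResolvent ω (σ n) (delta 0)) atTop (𝓝 η) := by
  choose u hu using exists_tendsto_alternatingTail hσ ht
  refine exists_lp_tendsto_of_dominated ENNReal.ofNat_ne_top (bound := absPoly ω)
    (g := fun l => (-Complex.I) ^ (l + 1) * ((absPoly ω l * u l : ℝ) : ℂ))
    (by simpa using hp) (fun n l => ?_) fun l => ?_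
  · rw [coe_truncResolvent_delta_zero hω, resolventColumn, norm_mul, norm_pow, norm_neg,
      Complex.norm_I, one_pow, one_mul, Complex.norm_real]
    exact abs_columnModulus_le hω _ _
  · simp_rw [coe_truncResolvent_delta_zero hω]
    exact ((Complex.continuous_ofReal.tendsto _).comp ((hu l).const_mul _)).const_mul _

theorem exists_isExtensionResolvent (hω : ∀ n, 1 ≤ n → 0 < ω n)
    (hp : Summable fun l => absPoly ω l ^ 2) (hσ : Tendsto σ atTop atTop)
    (ht : Tendsto (fun n => ∑ j ∈ Finset.range (σ n + 1), (-1) ^ j * (christoffelSum ω j)⁻¹)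
      atTop (𝓝 t)) :
    ∃ Y, IsStrongLimit (fun n => truncResolvent ω (σ n)) Y ∧
      IsExtensionResolvent (jacobiOp ω) Complex.I Y := by
  obtain ⟨η, hη⟩ := exists_tendsto_truncResolvent_delta_zero hω hp hσ ht
  have hstar : Tendsto (fun n => star (truncResolvent ω (σ n)) (delta 0)) atTop (𝓝 (star η)) :=
    hη.star.congr fun n => (star_truncResolvent_delta_zero ω (σ n)).symm
  have hX (x : (jacobiOp ω).domain) := hσ.eventually (eventually_truncResolvent_smul_sub x)
  have hX' (x : (jacobiOp ω).domain) := hσ.eventually (eventually_star_truncResolvent_smul_sub x)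
  obtain ⟨Y, hY⟩ := exists_isStrongLimit_of_tendsto_delta_zero hω
    (fun n => norm_truncResolvent_le_one ω (σ n)) hX hη
  obtain ⟨Z, hZ⟩ := exists_isStrongLimit_of_tendsto_delta_zero hω
    (fun n => (norm_star _).trans_le (norm_truncResolvent_le_one ω (σ n))) hX' hstar
  exact ⟨Y, hY, isExtensionResolvent_of_tendsto hY hZ
    (fun n => star_truncResolvent_sub_self ω (σ n))
    (fun n => star_truncResolvent_sub_self' ω (σ n)) hX hX'⟩

theorem IsExtensionResolvent.isResolvent_adjointOnImage {z : ℂ} {Y : EllTwo →L[ℂ] EllTwo}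
    (h : IsExtensionResolvent (jacobiOp ω) z Y) : IsResolvent (adjointOnImage ω Y) z Y :=
  ⟨fun ξ => ⟨_, h.smul_sub_adjointRestrict dense_finSupp ξ⟩,
    h.apply_smul_sub_adjointRestrict dense_finSupp⟩

theorem inner_delta_zero_truncResolvent (ω : ℕ → ℝ) (m : ℕ) :
    inner ℂ (delta 0) (truncResolvent ω m (delta 0)) = truncStieltjes ω m := by
  rw [truncResolvent_eq_deltaOperator, deltaOperator_apply, delta_zero_comp_val,
    Matrix.mulVec_single_one]
  exact (orthonormal_delta_fin m).inner_right_fintype _ 0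

theorem IsStrongLimit.inner_delta_zero {Y : EllTwo →L[ℂ] EllTwo} {g : ℂ}
    (hY : IsStrongLimit (fun n => truncResolvent ω (σ n)) Y)
    (hg : Tendsto (fun n => truncStieltjes ω (σ n)) atTop (𝓝 g)) :
    inner ℂ (delta 0) (Y (delta 0)) = g :=
  tendsto_nhds_unique (tendsto_const_nhds.inner (hY (delta 0)))
    (hg.congr fun n => (inner_delta_zero_truncResolvent ω (σ n)).symm)

theorem hasStieltjesTransform_adjointOnImage {Y : EllTwo →L[ℂ] EllTwo} {g : ℂ}
    (h : IsExtensionResolvent (jacobiOp ω) Complex.I Y)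
    (hY : IsStrongLimit (fun n => truncResolvent ω (σ n)) Y)
    (hg : Tendsto (fun n => truncStieltjes ω (σ n)) atTop (𝓝 g)) :
    HasStieltjesTransform (adjointOnImage ω Y) Complex.I g :=
  ⟨Y, h.isResolvent_adjointOnImage, hY.inner_delta_zero hg⟩

end StrongLimits

section Stieltjes

variable {ω : ℕ → ℝ}

theorem tendsto_truncStieltjes (hω : ∀ n, 1 ≤ n → 0 < ω n) {σ : ℕ → ℕ} {t : ℝ}
    (ht : Tendsto (fun n => ∑ j ∈ Finset.range (σ n + 1), (-1) ^ j * (christoffelSum ω j)⁻¹)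
      atTop (𝓝 t)) :
    Tendsto (fun n => truncStieltjes ω (σ n)) atTop (𝓝 (-Complex.I * t)) := by
  simp_rw [truncStieltjes_eq hω]
  exact ((Complex.continuous_ofReal.tendsto _).comp ht).const_mul _

theorem exists_tendsto_truncStieltjes (hω : ∀ n, 1 ≤ n → 0 < ω n) {s : ℝ}
    (hs : Tendsto (fun n => (christoffelSum ω n)⁻¹) atTop (𝓝 s)) :
    ∃ t : ℝ, Tendsto (fun m => truncStieltjes ω (2 * m)) atTop
        (𝓝 (-Complex.I * (t + s : ℝ))) ∧
      Tendsto (fun m => truncStieltjes ω (2 * m + 1)) atTop (𝓝 (-Complex.I * t)) := by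
  obtain ⟨t, heven, hodd⟩ := exists_tendsto_alternating_sum (inv_christoffelSum_antitone ω) hs
  exact ⟨t, tendsto_truncStieltjes hω heven, tendsto_truncStieltjes hω hodd⟩

theorem tendsto_truncStieltjes_two_mul (hω : ∀ n, 1 ≤ n → 0 < ω n) :
    Tendsto (fun m => truncStieltjes ω (2 * m)) atTop (𝓝 (GEven ω)) := by
  obtain ⟨s, -, hs⟩ := exists_tendsto_inv_christoffelSum ω
  obtain ⟨t, heven, -⟩ := exists_tendsto_truncStieltjes hω hs
  exact tendsto_nhds_limUnder ⟨_, heven⟩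

theorem tendsto_truncStieltjes_two_mul_add_one (hω : ∀ n, 1 ≤ n → 0 < ω n) :
    Tendsto (fun m => truncStieltjes ω (2 * m + 1)) atTop (𝓝 (GOdd ω)) := by
  obtain ⟨s, -, hs⟩ := exists_tendsto_inv_christoffelSum ω
  obtain ⟨t, -, hodd⟩ := exists_tendsto_truncStieltjes hω hs
  exact tendsto_nhds_limUnder ⟨_, hodd⟩

theorem GEven_sub_GOdd (hω : ∀ n, 1 ≤ n → 0 < ω n) {s : ℝ}
    (hs : Tendsto (fun n => (christoffelSum ω n)⁻¹) atTop (𝓝 s)) :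
    GEven ω - GOdd ω = -Complex.I * s := by
  obtain ⟨t, heven, hodd⟩ := exists_tendsto_truncStieltjes hω hs
  rw [GEven, GOdd, heven.limUnder_eq, hodd.limUnder_eq]
  push_cast
  ring

theorem GEven_ne_GOdd_iff (hω : ∀ n, 1 ≤ n → 0 < ω n) {s : ℝ}
    (hs : Tendsto (fun n => (christoffelSum ω n)⁻¹) atTop (𝓝 s)) :
    GEven ω ≠ GOdd ω ↔ s ≠ 0 := by
  rw [← sub_ne_zero, GEven_sub_GOdd hω hs]
  simp

theorem PropertySC.exists_pos_tendsto_inv_christoffelSum (hω : ∀ n, 1 ≤ n → 0 < ω n)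
    (h : PropertySC ω) :
    ∃ s, 0 < s ∧ Tendsto (fun n => (christoffelSum ω n)⁻¹) atTop (𝓝 s) := by
  obtain ⟨s, hs₀, hs⟩ := exists_tendsto_inv_christoffelSum ω
  refine ⟨s, ?_, hs⟩
  rcases h with hG | ⟨L, hL, hprod⟩ | ⟨S, hsum⟩
  · exact hs₀.lt_of_ne' ((GEven_ne_GOdd_iff hω hs).1 hG)
  · simp_rw [prod_one_sub_seqB_div_seqB hω] at hprod
    exact tendsto_nhds_unique hprod hs ▸ hL
  · exact pos_of_tendsto_sum_seqB_div_seqB hω hs hsum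

end Stieltjes

section OrthogonalPolynomials

open Polynomial

variable {𝕜 V : Type*} [RCLike 𝕜] [NormedAddCommGroup V] [InnerProductSpace 𝕜 V] {ω : ℕ → ℝ}
  {T : Module.End 𝕜 V} {e : ℕ → V}

/-- The moments `⟨T ^ n x, x⟩` of a symmetric operator `T` with respect to the state given by `x`;
the real part discards nothing, since these numbers are real. -/
noncomputable def stateMoment (T : Module.End 𝕜 V) (x : V) (n : ℕ) : ℝ :=
  RCLike.re (inner 𝕜 x ((T ^ n) x))

theorem coe_stateMoment (hT : T.IsSymmetric) (x : V) (n : ℕ) :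
    (stateMoment T x n : 𝕜) = inner 𝕜 x ((T ^ n) x) :=
  (hT.pow n).coe_re_inner_self_apply x

theorem isSymmetric_aeval_map (hT : T.IsSymmetric) (p : ℝ[X]) :
    (aeval T (p.map (algebraMap ℝ 𝕜))).IsSymmetric := by
  induction p using Polynomial.induction_on' with
  | add p q hp hq => simpa only [Polynomial.map_add, map_add] using hp.add hq
  | monomial n a =>
    rw [map_monomial, aeval_monomial, ← Algebra.smul_def]
    exact (hT.pow n).smul (RCLike.conj_ofReal a)

theorem coe_momentFunctional_stateMoment (hT : T.IsSymmetric) (x : V) (p : ℝ[X]) :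
    (momentFunctional (stateMoment T x) p : 𝕜) =
      inner 𝕜 x (aeval T (p.map (algebraMap ℝ 𝕜)) x) := by
  rw [momentFunctional, Polynomial.sum_over_range _ (by simp), aeval_def, eval₂_map,
    eval₂_eq_sum_range, LinearMap.sum_apply, inner_sum]
  simp [coe_stateMoment hT, inner_smul_right]

theorem coe_momentFunctional_stateMoment_mul (hT : T.IsSymmetric) (x : V) (p q : ℝ[X]) :
    (momentFunctional (stateMoment T x) (p * q) : 𝕜) =
      inner 𝕜 (aeval T (p.map (algebraMap ℝ 𝕜)) x) (aeval T (q.map (algebraMap ℝ 𝕜)) x) := by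
  rw [coe_momentFunctional_stateMoment hT, Polynomial.map_mul, map_mul, Module.End.mul_apply,
    isSymmetric_aeval_map hT]

/-- The monic orthogonal polynomials with Jacobi sequence `ω`. -/
noncomputable def monicPoly (ω : ℕ → ℝ) : ℕ → ℝ[X]
  | 0 => 1
  | 1 => X
  | n + 2 => X * monicPoly ω (n + 1) - C (ω (n + 1)) * monicPoly ω n

theorem monicPoly_monic_natDegree (ω : ℕ → ℝ) :
    ∀ n, (monicPoly ω n).Monic ∧ (monicPoly ω n).natDegree = n
  | 0 => by simp [monicPoly]
  | 1 => by simp [monicPoly, monic_X]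
  | n + 2 => by
    obtain ⟨-, hdeg⟩ := monicPoly_monic_natDegree ω n
    obtain ⟨hmonic, hdeg'⟩ := monicPoly_monic_natDegree ω (n + 1)
    have hlead : (X * monicPoly ω (n + 1)).natDegree = n + 2 := by
      rw [natDegree_X_mul hmonic.ne_zero, hdeg']
    have hlt : (C (ω (n + 1)) * monicPoly ω n).natDegree <
        (X * monicPoly ω (n + 1)).natDegree :=
      hlead ▸ (natDegree_C_mul_le _ _).trans_lt (by omega)
    exact ⟨(monic_X.mul hmonic).sub_of_left (degree_lt_degree hlt),
      (natDegree_sub_eq_left_of_natDegree_lt hlt).trans hlead⟩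

theorem aeval_monicPoly_apply (hω : ∀ n, 1 ≤ n → 0 < ω n) (he₀ : T (e 0) = (√(ω 1) : 𝕜) • e 1)
    (he : ∀ n, T (e (n + 1)) = (√(ω (n + 1)) : 𝕜) • e n + (√(ω (n + 2)) : 𝕜) • e (n + 2)) :
    ∀ n, aeval T ((monicPoly ω n).map (algebraMap ℝ 𝕜)) (e 0) =
      ((∏ k ∈ Finset.range n, √(ω (k + 1)) : ℝ) : 𝕜) • e n
  | 0 => by simp [monicPoly]
  | 1 => by simp [monicPoly, he₀]
  | n + 2 => by
    have hn := aeval_monicPoly_apply hω he₀ he n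
    have hn' := aeval_monicPoly_apply hω he₀ he (n + 1)
    have hsq : (√(ω (n + 1)) : 𝕜) * √(ω (n + 1)) = (ω (n + 1) : 𝕜) := by
      exact_mod_cast Real.mul_self_sqrt (hω (n + 1) n.succ_pos).le
    simp only [monicPoly, Polynomial.map_sub, Polynomial.map_mul, map_X, map_C, map_sub, map_mul,
      aeval_X, aeval_C, LinearMap.sub_apply, Module.End.mul_apply, Module.algebraMap_end_apply,
      hn, hn', map_smul, he, Finset.prod_range_succ, RCLike.algebraMap_eq_ofReal]
    rw [← hsq]
    module

theorem isJacobiSequence_stateMoment (hω : ∀ n, 1 ≤ n → 0 < ω n) (hT : T.IsSymmetric)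
    (horth : Orthonormal 𝕜 e) (he₀ : T (e 0) = (√(ω 1) : 𝕜) • e 1)
    (he : ∀ n, T (e (n + 1)) = (√(ω (n + 1)) : 𝕜) • e n + (√(ω (n + 2)) : 𝕜) • e (n + 2)) :
    IsJacobiSequence (stateMoment T (e 0)) ω := by
  have hinner (m n : ℕ) :
      momentFunctional (stateMoment T (e 0)) (monicPoly ω m * monicPoly ω n) =
        (∏ k ∈ Finset.range m, √(ω (k + 1))) * (∏ k ∈ Finset.range n, √(ω (k + 1))) *
          if m = n then 1 else 0 := by
    rw [← RCLike.ofReal_inj (K := 𝕜), coe_momentFunctional_stateMoment_mul hT,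
      aeval_monicPoly_apply hω he₀ he, aeval_monicPoly_apply hω he₀ he, inner_smul_left,
      inner_smul_right, orthonormal_iff_ite.1 horth, RCLike.conj_ofReal]
    split_ifs <;> push_cast <;> ring
  refine ⟨?_, monicPoly ω, monicPoly_monic_natDegree ω, fun m n hmn => ?_, fun n => ?_,
    mul_one X, fun n => (sub_add_cancel _ _).symm⟩
  · simp [stateMoment, horth.1 0]
  · rw [hinner, if_neg hmn, mul_zero]
  · rw [hinner, if_pos rfl, mul_one]
    exact mul_pos (prod_sqrt_pos hω n) (prod_sqrt_pos hω n)

end OrthogonalPolynomials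

section Moments

variable {ω : ℕ → ℝ}

/-- The Jacobi operator as an endomorphism of the space of finitely supported sequences. -/
noncomputable def jacobiEnd (ω : ℕ → ℝ) : Module.End ℂ finSupp :=
  (jacobiOp ω).toFun.codRestrict finSupp fun x => jacobiAction_support_finite ω _ x.2

/-- The vector `δ_k` as an element of the domain of the Jacobi operator. -/
noncomputable def finSuppDelta (k : ℕ) : finSupp := ⟨delta k, delta_mem_finSupp k⟩

theorem isSymmetric_jacobiEnd (ω : ℕ → ℝ) : (jacobiEnd ω).IsSymmetric :=
  fun x y => isFormalAdjoint_jacobiOp ω x y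

theorem orthonormal_finSuppDelta : Orthonormal ℂ finSuppDelta :=
  finSupp.subtypeₗᵢ.orthonormal_comp_iff.1 orthonormal_delta

/-- The moments `⟨X ^ n δ_0, δ_0⟩` of the Jacobi operator. -/
noncomputable def jacobiMoment (ω : ℕ → ℝ) : ℕ → ℝ := stateMoment (jacobiEnd ω) (finSuppDelta 0)

theorem isJacobiSequence_jacobiMoment (hω : ∀ n, 1 ≤ n → 0 < ω n) :
    IsJacobiSequence (jacobiMoment ω) ω :=
  isJacobiSequence_stateMoment hω (isSymmetric_jacobiEnd ω) orthonormal_finSuppDelta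
    (Subtype.ext (jacobiOp_delta_zero ω)) fun n => Subtype.ext (jacobiOp_delta_succ ω n)

theorem hasMoments_of_jacobiOp_le {T : EllTwo →ₗ.[ℂ] EllTwo} (hT : jacobiOp ω ≤ T) :
    HasMoments T (jacobiMoment ω) := by
  refine ⟨fun n => (jacobiEnd ω ^ n) (finSuppDelta 0), rfl, fun n => ⟨hT.1 (Subtype.prop _), ?_⟩,
    fun n => (coe_stateMoment (isSymmetric_jacobiEnd ω) (finSuppDelta 0) n).symm⟩
  have hsucc : (jacobiEnd ω ^ (n + 1)) (finSuppDelta 0) =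
      jacobiEnd ω ((jacobiEnd ω ^ n) (finSuppDelta 0)) := by
    rw [pow_succ', Module.End.mul_apply]
  exact (hT.2 rfl).symm.trans (congrArg Subtype.val hsucc).symm

end Moments

end JacobiMoment

theorem mainTheorem7 (ω : ℕ → ℝ) (hω : ∀ n, 1 ≤ n → 0 < ω n) (hSC : PropertySC ω) :
    ∃ Yeven Yodd : EllTwo →L[ℂ] EllTwo,
      IsStrongLimit (fun m => truncResolvent ω (2 * m)) Yeven ∧
      IsStrongLimit (fun m => truncResolvent ω (2 * m + 1)) Yodd ∧
      LinearMap.range (Yeven : EllTwo →ₗ[ℂ] EllTwo) ≤ (jacobiOp ω).adjoint.domain ∧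
      LinearMap.range (Yodd : EllTwo →ₗ[ℂ] EllTwo) ≤ (jacobiOp ω).adjoint.domain ∧
      -- extensions of the Jacobi operator
      jacobiOp ω ≤ adjointOnImage ω Yeven ∧
      jacobiOp ω ≤ adjointOnImage ω Yodd ∧
      -- self-adjointness
      IsSelfAdjoint (adjointOnImage ω Yeven) ∧
      IsSelfAdjoint (adjointOnImage ω Yodd) ∧
      -- moments of all orders, with Jacobi sequence `ω`
      (∃ M : ℕ → ℝ,
        HasMoments (jacobiOp ω) M ∧
        HasMoments (adjointOnImage ω Yeven) M ∧
        HasMoments (adjointOnImage ω Yodd) M ∧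
        IsJacobiSequence M ω) ∧
      -- the Stieltjes transforms at `i`
      Tendsto (fun m : ℕ => truncStieltjes ω (2 * m)) atTop (𝓝 (GEven ω)) ∧
      Tendsto (fun m : ℕ => truncStieltjes ω (2 * m + 1)) atTop (𝓝 (GOdd ω)) ∧
      HasStieltjesTransform (adjointOnImage ω Yeven) Complex.I (GEven ω) ∧
      HasStieltjesTransform (adjointOnImage ω Yodd) Complex.I (GOdd ω) ∧
      GEven ω ≠ GOdd ω := by
  obtain ⟨s, hs₀, hs⟩ := hSC.exists_pos_tendsto_inv_christoffelSum hω
  obtain ⟨t, heven, hodd⟩ := exists_tendsto_alternating_sum (inv_christoffelSum_antitone ω) hs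
  have hp := summable_absPoly_sq hs₀ hs
  obtain ⟨Ye, hYe, he⟩ := exists_isExtensionResolvent hω hp tendsto_two_mul_atTop heven
  obtain ⟨Yo, hYo, ho⟩ := exists_isExtensionResolvent hω hp tendsto_two_mul_add_one_atTop hodd
  have hXe := he.le_adjointRestrict dense_finSupp
  have hXo := ho.le_adjointRestrict dense_finSupp
  have hGe := tendsto_truncStieltjes_two_mul hω
  have hGo := tendsto_truncStieltjes_two_mul_add_one hω
  exact ⟨Ye, Yo, hYe, hYo, he.range_le_adjoint_domain, ho.range_le_adjoint_domain, hXe, hXo,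
    he.isSelfAdjoint_adjointRestrict dense_finSupp, ho.isSelfAdjoint_adjointRestrict dense_finSupp,
    ⟨jacobiMoment ω, hasMoments_of_jacobiOp_le le_rfl, hasMoments_of_jacobiOp_le hXe,
      hasMoments_of_jacobiOp_le hXo, isJacobiSequence_jacobiMoment hω⟩,
    hGe, hGo, hasStieltjesTransform_adjointOnImage he hYe hGe,
    hasStieltjesTransform_adjointOnImage ho hYo hGo, (GEven_ne_GOdd_iff hω hs).2 hs₀.ne'⟩
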